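/- Let $n\ge 2$ and let $\mathcal{K}_o^n$ be the set of compact convex subsets of $\mathbb{R}^n$ containing the origin in their interiors. For $K\in\mathcal{K}_o^n$ let $h_K(u)=\sup_{x\in K}\langle u,x\rangle$ be its support function and let $S(K,\cdot)$ be its surface area measure on the unit sphere $S^{n-1}$, that is, $S(K,E)=\mathcal{H}^{n-1}(\nu_K^{-1}(E))$ for Borel sets $E\subset S^{n-1}$, where $\nu_K$ is the Gauss map, which assigns to each boundary point of $K$ with a unique outer unit normal vector that vector. Let $\mathcal{I}$ be the class of continuous, strictly increasing functions $\varphi:(0,\infty)\to(0,\infty)$ with $\varphi(1)=1$, $\lim_{t\to0^+}\varphi(t)=0$ and $\lim_{t\to\infty}\varphi(t)=\infty$. For $K,M\in\mathcal{K}_o^n$ and $\varphi\in\mathcal{I}$, the Orlicz mixed volume is $$V_\varphi(K,M)=\frac1n\int_{S^{n-1}}\varphi\!\left(\frac{h_M(u)}{h_K(u)}\right)h_K(u)\,dS(K,u).$$ We say that $\varphi$ behaves like $t^n$ if there is $r>0$, $r\ne1$, such that $\varphi(rt)=r^n\varphi(t)$ for all $t>0$. Let $K,L\in\mathcal{K}_o^n$.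 Suppose that $\varphi\in\mathcal{I}$ is strictly convex and that $V_\varphi(K,M)=V_\varphi(L,M)$ for all $M\in\mathcal{K}_o^n$. Then $K$ and $L$ are dilatates of each other, i.e. $L=rK$ for some $r>0$. Moreover, $K=L$ unless $\varphi$ behaves like $t^n$. -/

import Mathlib

open MeasureTheory Set Filter Topology
open scoped Pointwise

namespace OrliczMixed

variable {n : ℕ}

/-- The support function `h_K(u) = sup_{x ∈ K} ⟨u, x⟩`. -/
noncomputable def supportFun (K : Set (EuclideanSpace ℝ (Fin n)))
    (u : EuclideanSpace ℝ (Fin n)) : ℝ :=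
  sSup ((fun x => inner ℝ u x) '' K)

/-- `u` is an outer unit normal vector of `K` at `x`, that is, `x` lies in the supporting
hyperplane `H(K, u) = {x : ⟨x, u⟩ = h_K(u)}`. -/
def IsOuterNormal (K : Set (EuclideanSpace ℝ (Fin n))) (x : EuclideanSpace ℝ (Fin n))
    (u : Metric.sphere (0 : EuclideanSpace ℝ (Fin n)) 1) : Prop :=
  inner ℝ x (u : EuclideanSpace ℝ (Fin n)) = supportFun K u

/-- `reg K`: the boundary points of `K` that have exactly one outer unit normal vector. -/
def regularBoundary (K : Set (EuclideanSpace ℝ (Fin n))) : Set (EuclideanSpace ℝ (Fin n)) :=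
  {x | x ∈ frontier K ∧ ∃! u, IsOuterNormal K x u}

/-- The Gauss map `ν_K`: the outer unit normal vector at a regular boundary point. -/
noncomputable def gaussMap (K : Set (EuclideanSpace ℝ (Fin n))) (x : regularBoundary K) :
    Metric.sphere (0 : EuclideanSpace ℝ (Fin n)) 1 :=
  x.2.2.choose

/-- The surface area measure `S(K, ·)` on the unit sphere: `S(K, E) = H^{n-1}(ν_K⁻¹(E))`, see
`surfaceAreaMeasure_apply`. The measure `H^{n-1}` is the Hausdorff measure in its Euclidean
normalization, restricted here to the set of regular boundary points. -/
noncomputable def surfaceAreaMeasure (K : Set (EuclideanSpace ℝ (Fin n))) :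
    Measure (Metric.sphere (0 : EuclideanSpace ℝ (Fin n)) 1) :=
  ((μHE[n - 1] : Measure (EuclideanSpace ℝ (Fin n))).comap
    (Subtype.val : regularBoundary K → EuclideanSpace ℝ (Fin n))).map (gaussMap K)

/-- The Orlicz mixed volume
`V_φ(K, L) = (1/n) ∫ φ(h_L(u) / h_K(u)) h_K(u) dS(K, u)` over the unit sphere. -/
noncomputable def orliczMixedVolume (φ : ℝ → ℝ) (K L : Set (EuclideanSpace ℝ (Fin n))) : ℝ :=
  (1 / (n : ℝ)) * ∫ u : Metric.sphere (0 : EuclideanSpace ℝ (Fin n)) 1,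
    φ (supportFun L u / supportFun K u) * supportFun K u ∂(surfaceAreaMeasure K)

/-- `L` is a dilatate of `K`: `L = r K` for some `r > 0`. -/
def IsDilatate (K L : Set (EuclideanSpace ℝ (Fin n))) : Prop :=
  ∃ r : ℝ, 0 < r ∧ L = r • K

/-- The class `𝓘` of continuous, strictly increasing functions `φ : (0, ∞) → (0, ∞)` with
`φ(1) = 1`, `φ(0+) = 0` and `φ(∞) = ∞`. Only the values on `(0, ∞)` matter. -/
structure ClassI (φ : ℝ → ℝ) : Prop where
  pos : ∀ t, 0 < t → 0 < φ t
  continuousOn : ContinuousOn φ (Ioi 0)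
  strictMonoOn : StrictMonoOn φ (Ioi 0)
  map_one : φ 1 = 1
  tendsto_zero : Tendsto φ (𝓝[>] 0) (𝓝 0)
  tendsto_atTop : Tendsto φ atTop atTop

/-- `φ` behaves like `t ^ n`: for some `r > 0`, `r ≠ 1`, one has `φ(r t) = r ^ n φ(t)` for all
`t > 0`. -/
def BehavesLikePow (n : ℕ) (φ : ℝ → ℝ) : Prop :=
  ∃ r : ℝ, 0 < r ∧ r ≠ 1 ∧ ∀ t : ℝ, 0 < t → φ (r * t) = r ^ n * φ t

/-! The following facts show that `surfaceAreaMeasure` is given by the formula in its docstring. -/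

theorem isOuterNormal_gaussMap (K : Set (EuclideanSpace ℝ (Fin n))) (x : regularBoundary K) :
    IsOuterNormal K x (gaussMap K x) :=
  x.2.2.choose_spec.1

theorem isOuterNormal_iff (K : ConvexBody (EuclideanSpace ℝ (Fin n)))
    {x : EuclideanSpace ℝ (Fin n)} (hx : x ∈ frontier (K : Set (EuclideanSpace ℝ (Fin n))))
    (u : Metric.sphere (0 : EuclideanSpace ℝ (Fin n)) 1) :
    IsOuterNormal (K : Set (EuclideanSpace ℝ (Fin n))) x u ↔
      ∀ y ∈ (K : Set (EuclideanSpace ℝ (Fin n))),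
        inner ℝ (u : EuclideanSpace ℝ (Fin n)) y ≤ inner ℝ (u : EuclideanSpace ℝ (Fin n)) x := by
  have hxK : x ∈ (K : Set (EuclideanSpace ℝ (Fin n))) := K.isClosed.frontier_subset hx
  have hbdd : BddAbove ((fun y => inner ℝ (u : EuclideanSpace ℝ (Fin n)) y) ''
      (K : Set (EuclideanSpace ℝ (Fin n)))) :=
    (K.isCompact.image (by fun_prop)).bddAbove
  unfold IsOuterNormal supportFun
  rw [real_inner_comm]
  constructor
  · intro h y hy
    rw [h]
    exact le_csSup hbdd ⟨y, hy, rfl⟩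
  · intro h
    refine le_antisymm (le_csSup hbdd ⟨x, hxK, rfl⟩) (csSup_le ⟨_, x, hxK, rfl⟩ ?_)
    rintro _ ⟨y, hy, rfl⟩
    exact h y hy

/-- The set of pairs of a boundary point and an outer normal vector there is closed. -/
theorem isClosed_normalBundle (K : ConvexBody (EuclideanSpace ℝ (Fin n))) :
    IsClosed {p : EuclideanSpace ℝ (Fin n) × Metric.sphere (0 : EuclideanSpace ℝ (Fin n)) 1 |
      p.1 ∈ frontier (K : Set (EuclideanSpace ℝ (Fin n))) ∧
        IsOuterNormal (K : Set (EuclideanSpace ℝ (Fin n))) p.1 p.2} := by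
  have : {p : EuclideanSpace ℝ (Fin n) × Metric.sphere (0 : EuclideanSpace ℝ (Fin n)) 1 |
      p.1 ∈ frontier (K : Set (EuclideanSpace ℝ (Fin n))) ∧
        IsOuterNormal (K : Set (EuclideanSpace ℝ (Fin n))) p.1 p.2} =
      (Prod.fst ⁻¹' frontier (K : Set (EuclideanSpace ℝ (Fin n)))) ∩
      ⋂ y ∈ (K : Set (EuclideanSpace ℝ (Fin n))),
        {p : EuclideanSpace ℝ (Fin n) × Metric.sphere (0 : EuclideanSpace ℝ (Fin n)) 1 |
          inner ℝ (p.2 : EuclideanSpace ℝ (Fin n)) y ≤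
          inner ℝ (p.2 : EuclideanSpace ℝ (Fin n)) p.1} := by
    ext p
    simp only [mem_ofPred_eq, mem_inter_iff, mem_preimage, mem_iInter]
    exact and_congr_right fun h => isOuterNormal_iff K h p.2
  rw [this]
  refine (isClosed_frontier.preimage continuous_fst).inter
    (isClosed_biInter fun y _ => isClosed_le ?_ ?_) <;> fun_prop

theorem measurableSet_regularBoundary (K : ConvexBody (EuclideanSpace ℝ (Fin n))) :
    MeasurableSet (regularBoundary (K : Set (EuclideanSpace ℝ (Fin n)))) := by
  set N := {p : EuclideanSpace ℝ (Fin n) × Metric.sphere (0 : EuclideanSpace ℝ (Fin n)) 1 |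
      p.1 ∈ frontier (K : Set (EuclideanSpace ℝ (Fin n))) ∧
        IsOuterNormal (K : Set (EuclideanSpace ℝ (Fin n))) p.1 p.2} with hN
  have hNc : IsClosed N := isClosed_normalBundle K
  let F : ℕ → Set (EuclideanSpace ℝ (Fin n) × (Metric.sphere (0 : EuclideanSpace ℝ (Fin n)) 1 ×
      Metric.sphere (0 : EuclideanSpace ℝ (Fin n)) 1)) := fun m =>
    {q | (q.1, q.2.1) ∈ N ∧ (q.1, q.2.2) ∈ N ∧ 1 / ((m : ℝ) + 1) ≤ dist q.2.1 q.2.2}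
  have hF : ∀ m, IsClosed (F m) := fun m =>
    (hNc.preimage (f := fun q : EuclideanSpace ℝ (Fin n) ×
      (Metric.sphere (0 : EuclideanSpace ℝ (Fin n)) 1 ×
      Metric.sphere (0 : EuclideanSpace ℝ (Fin n)) 1) => (q.1, q.2.1)) (by fun_prop)).inter
    ((hNc.preimage (f := fun q : EuclideanSpace ℝ (Fin n) ×
      (Metric.sphere (0 : EuclideanSpace ℝ (Fin n)) 1 ×
      Metric.sphere (0 : EuclideanSpace ℝ (Fin n)) 1) => (q.1, q.2.2)) (by fun_prop)).inter
    (isClosed_le (f := fun _ => 1 / ((m : ℝ) + 1))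
      (g := fun q : EuclideanSpace ℝ (Fin n) ×
        (Metric.sphere (0 : EuclideanSpace ℝ (Fin n)) 1 ×
        Metric.sphere (0 : EuclideanSpace ℝ (Fin n)) 1) => dist q.2.1 q.2.2)
      (by fun_prop) (by fun_prop)))
  have hreg : regularBoundary (K : Set (EuclideanSpace ℝ (Fin n))) =
      (Prod.fst '' N) \ ⋃ m, Prod.fst '' F m := by
    ext x
    constructor
    · rintro ⟨hx, u, hu, huniq⟩
      refine ⟨⟨(x, u), ⟨hx, hu⟩, rfl⟩, ?_⟩
      simp only [mem_iUnion, not_exists]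
      rintro m ⟨⟨y, v, w⟩, ⟨hv, hw, hd⟩, rfl⟩
      rw [huniq v hv.2, huniq w hw.2, dist_self] at hd
      exact absurd hd (not_le.2 (by positivity))
    · rintro ⟨⟨⟨y, u⟩, hu, rfl⟩, hno⟩
      refine ⟨hu.1, u, hu.2, fun v hv => ?_⟩
      by_contra hvu
      obtain ⟨m, hm⟩ := exists_nat_one_div_lt (dist_pos.2 hvu)
      exact hno (mem_iUnion.2 ⟨m, (y, v, u), ⟨⟨hu.1, hv⟩, hu, hm.le⟩, rfl⟩)
  rw [hreg]
  exact (isClosedMap_fst_of_compactSpace _ hNc).measurableSet.diff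
    (MeasurableSet.iUnion fun m => (isClosedMap_fst_of_compactSpace _ (hF m)).measurableSet)

theorem continuous_gaussMap (K : ConvexBody (EuclideanSpace ℝ (Fin n))) :
    Continuous (gaussMap (K : Set (EuclideanSpace ℝ (Fin n)))) := by
  rw [continuous_iff_isClosed]
  intro C hC
  have h := isClosedMap_fst_of_compactSpace _
    ((isClosed_normalBundle K).inter (hC.preimage continuous_snd))
  convert h.preimage continuous_subtype_val using 1
  ext x
  constructor
  · intro hx
    exact ⟨(x, gaussMap _ x), ⟨⟨x.2.1, isOuterNormal_gaussMap _ x⟩, hx⟩, rfl⟩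
  · rintro ⟨⟨y, u⟩, ⟨⟨_, hu⟩, huC⟩, hy⟩
    have hy' : y = x := hy
    subst hy'
    have : gaussMap (K : Set (EuclideanSpace ℝ (Fin n))) x = u :=
      x.2.2.unique (isOuterNormal_gaussMap _ x) hu
    rw [mem_preimage, this]
    exact huC

theorem surfaceAreaMeasure_apply (K : ConvexBody (EuclideanSpace ℝ (Fin n)))
    {B : Set (Metric.sphere (0 : EuclideanSpace ℝ (Fin n)) 1)} (hB : MeasurableSet B) :
    surfaceAreaMeasure (K : Set (EuclideanSpace ℝ (Fin n))) B =
      μHE[n - 1] (Subtype.val '' (gaussMap (K : Set (EuclideanSpace ℝ (Fin n))) ⁻¹' B)) := by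
  have hm := (continuous_gaussMap K).measurable
  rw [surfaceAreaMeasure, Measure.map_apply hm hB]
  exact (MeasurableEmbedding.subtype_coe (measurableSet_regularBoundary K)).comap_apply _ _

end OrliczMixed

/-! If `g` is the gauge of `K`, then at almost every `z` the gradient of `g` is the boundary point
`u / h_K(u)` of the polar body, where `u` is the outer normal of `K` at the boundary point
`z / g z`. Since `n⁻¹ h_K dS(K, ·)` is the image of the volume of `K` under this normal map, the
Orlicz mixed volume becomes an integral over a convex body, `V_φ(K, M) = ∫_K φ(ρ z) dz` with
`ρ z = h_M(∇ g z)`.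

As `z ∈ K + t M` implies `g z ≤ 1 + t ρ z`, polar coordinates give `|K + t M| ≤ ∫_K (1 + t ρ)ⁿ`.
Comparing with the Brunn–Minkowski inequality to first order in `t` yields Minkowski's first
inequality: the mean of `ρ` over `K` is at least `r = (|M| / |K|)^(1/n)`. Jensen's inequality turns
this into `V_φ(K, M) ≥ φ(r) |K|`, and equality forces `ρ` to be constant, which means `M = r K`.

Now let `V_φ(K, ·) = V_φ(L, ·)` and `r = (|K| / |L|)^(1/n)`. Evaluating both functionals at `c K`
and at `c r L` gives two opposite inequalities, hence `φ(r c) = rⁿ φ(c)` for all `c > 0`. For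
`c = 1` this is the equality case `K = r L`. -/

namespace OrliczMixed

open scoped ENNReal NNReal RealInnerProductSpace

section BrunnMinkowski

theorem volume_add_volume_le_of_isCompact {A B : Set ℝ} (hA : IsCompact A) (hB : IsCompact B)
    (hA₀ : A.Nonempty) (hB₀ : B.Nonempty) : volume A + volume B ≤ volume (A + B) := by
  obtain ⟨a, ha, ha_max⟩ := hA.exists_isGreatest hA₀
  obtain ⟨b, hb, hb_min⟩ := hB.exists_isLeast hB₀
  -- The translates `b + A` and `a + B` lie in `A + B` and meet only at `a + b`.
  have hinter : volume ((b +ᵥ A) ∩ (a +ᵥ B)) = 0 := by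
    refine measure_mono_null (t := {a + b}) ?_ (measure_singleton _)
    rintro _ ⟨⟨x, hx, rfl⟩, y, hy, h⟩
    have hxa := ha_max hx
    have hby := hb_min hy
    simp only [vadd_eq_add] at h
    exact mem_singleton_of_eq (show b + x = a + b by linarith)
  have hsub : (b +ᵥ A) ∪ (a +ᵥ B) ⊆ A + B := by
    refine union_subset ?_ (vadd_set_subset_add ha)
    rw [add_comm A B]
    exact vadd_set_subset_add hb
  calc volume A + volume B = volume (b +ᵥ A) + volume (a +ᵥ B) := by simp only [measure_vadd]
    _ = volume ((b +ᵥ A) ∪ (a +ᵥ B)) := by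
      rw [← measure_union_add_inter _ (hB.vadd a).measurableSet, hinter, add_zero]
    _ ≤ volume (A + B) := measure_mono hsub

theorem volume_add_volume_le {A B : Set ℝ} (hA : MeasurableSet A) (hB : MeasurableSet B)
    (hA₀ : A.Nonempty) (hB₀ : B.Nonempty) : volume A + volume B ≤ volume (A + B) := by
  obtain ⟨a, ha⟩ := hA₀
  obtain ⟨b, hb⟩ := hB₀
  rw [hA.measure_eq_iSup_isCompact, hB.measure_eq_iSup_isCompact]
  simp only [iSup_and']
  refine ENNReal.biSup_add_biSup_le' (p := fun S => S ⊆ A ∧ IsCompact S)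
    (q := fun T => T ⊆ B ∧ IsCompact T) ⟨∅, empty_subset _, isCompact_empty⟩
    ⟨∅, empty_subset _, isCompact_empty⟩ fun S ⟨hSA, hS⟩ T ⟨hTB, hT⟩ => ?_
  calc volume S + volume T ≤ volume (insert a S) + volume (insert b T) := by
        gcongr <;> exact subset_insert _ _
    _ ≤ volume (insert a S + insert b T) :=
      volume_add_volume_le_of_isCompact (hS.insert a) (hT.insert b) (insert_nonempty _ _)
        (insert_nonempty _ _)
    _ ≤ volume (A + B) := by
      gcongr
      exacts [insert_subset ha hSA, insert_subset hb hTB]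

/-- The Prékopa–Leindler inequality for the measure `μ`, as a property of `μ` that can be carried
along products and linear maps. -/
def SatisfiesPrekopaLeindler {E : Type*} [AddCommGroup E] [Module ℝ E] [MeasurableSpace E]
    (μ : Measure E) : Prop :=
  ∀ ⦃a b : ℝ⦄, 0 < a → 0 < b → a + b = 1 → ∀ ⦃f g h : E → ℝ≥0∞⦄,
    Measurable f → Measurable g → Measurable h →
    (∀ x y, f x ^ a * g y ^ b ≤ h (a • x + b • y)) →
      (∫⁻ x, f x ∂μ) ^ a * (∫⁻ x, g x ∂μ) ^ b ≤ ∫⁻ x, h x ∂μ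

theorem lintegral_eq_lintegral_Ioo_meas_lt {α : Type*} [MeasurableSpace α] (μ : Measure α)
    {f : α → ℝ≥0∞} (hf : Measurable f) (hf₁ : ∀ x, f x ≤ 1) :
    ∫⁻ x, f x ∂μ = ∫⁻ t in Ioo (0 : ℝ) 1, μ {x | ENNReal.ofReal t < f x} := by
  have hf_top : ∀ x, f x ≠ ∞ := fun x => ne_top_of_le_ne_top ENNReal.one_ne_top (hf₁ x)
  have hlayer := lintegral_eq_lintegral_meas_lt μ (f := fun x => (f x).toReal)
    (Eventually.of_forall fun x => ENNReal.toReal_nonneg) hf.ennreal_toReal.aemeasurable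
  rw [← lintegral_congr fun x => ENNReal.ofReal_toReal (hf_top x), hlayer, ← Ioi_inter_Iio,
    inter_comm, ← setLIntegral_indicator measurableSet_Iio]
  refine setLIntegral_congr_fun measurableSet_Ioi fun t ht => ?_
  by_cases ht₁ : t < 1
  · rw [indicator_of_mem (mem_Iio.2 ht₁)]
    congr 1
    ext x
    exact (ENNReal.ofReal_lt_iff_lt_toReal (le_of_lt ht) (hf_top x)).symm
  · rw [indicator_of_notMem (by simpa using ht₁)]
    convert measure_empty (μ := μ)
    rw [eq_empty_iff_forall_notMem]
    exact fun x hx => ht₁ (hx.trans_le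
      (ENNReal.toReal_le_of_le_ofReal zero_le_one (by simpa using hf₁ x)))

variable {a b : ℝ}

theorem volume_superlevel_add_le {f g h : ℝ → ℝ≥0∞} (hf : Measurable f) (hg : Measurable g)
    (ha : 0 < a) (hb : 0 < b) (hab : a + b = 1) {s : ℝ≥0∞} (hs₀ : s ≠ 0) (hs : s ≠ ∞)
    (hsf : s < ⨆ x, f x) (hsg : s < ⨆ x, g x)
    (hfgh : ∀ x y, f x ^ a * g y ^ b ≤ h (a • x + b • y)) :
    ENNReal.ofReal a * volume {x | s < f x} + ENNReal.ofReal b * volume {x | s < g x} ≤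
      volume {x | s < h x} := by
  have hsmul : ∀ {c : ℝ}, 0 < c → ∀ S : Set ℝ, ENNReal.ofReal c * volume S = volume (c • S) :=
    fun hc S => by rw [Measure.addHaar_smul, Module.finrank_self, pow_one, abs_of_pos hc]
  obtain ⟨x₀, hx₀⟩ := lt_iSup_iff.1 hsf
  obtain ⟨y₀, hy₀⟩ := lt_iSup_iff.1 hsg
  rw [hsmul ha, hsmul hb]
  refine (volume_add_volume_le ((measurableSet_lt measurable_const hf).const_smul₀ _)
    ((measurableSet_lt measurable_const hg).const_smul₀ _) ⟨_, smul_mem_smul_set hx₀⟩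
    ⟨_, smul_mem_smul_set hy₀⟩).trans (measure_mono ?_)
  rintro _ ⟨_, ⟨x, hx, rfl⟩, _, ⟨y, hy, rfl⟩, rfl⟩
  calc s = s ^ a * s ^ b := by rw [← ENNReal.rpow_add _ _ hs₀ hs, hab, ENNReal.rpow_one]
    _ < f x ^ a * g y ^ b :=
      ENNReal.mul_lt_mul (ENNReal.rpow_lt_rpow hx ha) (ENNReal.rpow_lt_rpow hy hb)
    _ ≤ h (a • x + b • y) := hfgh x y

theorem add_lintegral_le_of_iSup_eq_one {f g h : ℝ → ℝ≥0∞} (hf : Measurable f)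
    (hg : Measurable g) (hh : Measurable h) (ha : 0 < a) (hb : 0 < b) (hab : a + b = 1)
    (hf₁ : ⨆ x, f x = 1) (hg₁ : ⨆ x, g x = 1)
    (hfgh : ∀ x y, f x ^ a * g y ^ b ≤ h (a • x + b • y)) :
    ENNReal.ofReal a * (∫⁻ x, f x) + ENNReal.ofReal b * ∫⁻ x, g x ≤ ∫⁻ x, h x := by
  have hf_le : ∀ x, f x ≤ 1 := fun x => hf₁ ▸ le_iSup f x
  have hg_le : ∀ x, g x ≤ 1 := fun x => hg₁ ▸ le_iSup g x
  have hmeas : ∀ k : ℝ → ℝ≥0∞, Measurable fun t : ℝ => volume {x | ENNReal.ofReal t < k x} :=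
    fun k => Antitone.measurable fun s t hst =>
      measure_mono fun x hx => (ENNReal.ofReal_le_ofReal hst).trans_lt hx
  have hfgh_min : ∀ x y, f x ^ a * g y ^ b ≤ min (h (a • x + b • y)) 1 := fun x y =>
    le_min (hfgh x y) (mul_le_one' (ENNReal.rpow_le_one (hf_le x) ha.le)
      (ENNReal.rpow_le_one (hg_le y) hb.le))
  calc ENNReal.ofReal a * (∫⁻ x, f x) + ENNReal.ofReal b * ∫⁻ x, g x
      = ∫⁻ t in Ioo (0 : ℝ) 1, (ENNReal.ofReal a * volume {x | ENNReal.ofReal t < f x} +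
          ENNReal.ofReal b * volume {x | ENNReal.ofReal t < g x}) := by
        rw [lintegral_eq_lintegral_Ioo_meas_lt volume hf hf_le,
          lintegral_eq_lintegral_Ioo_meas_lt volume hg hg_le,
          lintegral_add_left ((hmeas f).const_mul _), lintegral_const_mul _ (hmeas f),
          lintegral_const_mul _ (hmeas g)]
    _ ≤ ∫⁻ t in Ioo (0 : ℝ) 1, volume {x | ENNReal.ofReal t < min (h x) 1} := by
        refine setLIntegral_mono' measurableSet_Ioo fun t ht => ?_
        have ht₁ : ENNReal.ofReal t < 1 := by simpa using ht.2
        exact volume_superlevel_add_le hf hg ha hb hab (by simpa using ht.1) ENNReal.ofReal_ne_top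
          (hf₁ ▸ ht₁) (hg₁ ▸ ht₁) hfgh_min
    _ = ∫⁻ x, min (h x) 1 := (lintegral_eq_lintegral_Ioo_meas_lt volume
        (hh.min measurable_const) fun x => min_le_right _ _).symm
    _ ≤ ∫⁻ x, h x := lintegral_mono fun x => min_le_left _ _

theorem rpow_mul_rpow_le_add (ha : 0 < a) (hb : 0 < b) (hab : a + b = 1) (x y : ℝ≥0∞) :
    x ^ a * y ^ b ≤ ENNReal.ofReal a * x + ENNReal.ofReal b * y := by
  have hconj : a⁻¹.HolderConjugate b⁻¹ := by
    rw [Real.holderConjugate_iff]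
    exact ⟨(one_lt_inv₀ ha).2 (by linarith), by simpa using hab⟩
  have h := ENNReal.young_inequality (x ^ a) (y ^ b) hconj
  rwa [← ENNReal.rpow_mul, ← ENNReal.rpow_mul, mul_inv_cancel₀ ha.ne', mul_inv_cancel₀ hb.ne',
    ENNReal.rpow_one, ENNReal.rpow_one, ENNReal.ofReal_inv_of_pos ha, ENNReal.ofReal_inv_of_pos hb,
    div_eq_mul_inv, div_eq_mul_inv, inv_inv, inv_inv, mul_comm x, mul_comm y] at h

theorem rpow_lintegral_mul_rpow_lintegral_le_of_bounded {f g h : ℝ → ℝ≥0∞} (hf : Measurable f)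
    (hg : Measurable g) (hh : Measurable h) (ha : 0 < a) (hb : 0 < b) (hab : a + b = 1)
    (hf_top : ⨆ x, f x ≠ ∞) (hg_top : ⨆ x, g x ≠ ∞)
    (hfgh : ∀ x y, f x ^ a * g y ^ b ≤ h (a • x + b • y)) :
    (∫⁻ x, f x) ^ a * (∫⁻ x, g x) ^ b ≤ ∫⁻ x, h x := by
  obtain hf₀ | hf₀ := eq_or_ne (⨆ x, f x) 0
  · simp [ENNReal.iSup_eq_zero.1 hf₀, ha]
  obtain hg₀ | hg₀ := eq_or_ne (⨆ x, g x) 0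
  · simp [ENNReal.iSup_eq_zero.1 hg₀, hb]
  set F := ⨆ x, f x
  set G := ⨆ x, g x
  set s := F ^ a * G ^ b with hs
  have hFa : F ^ a ≠ ∞ := ENNReal.rpow_ne_top_of_nonneg ha.le hf_top
  have hGb : G ^ b ≠ ∞ := ENNReal.rpow_ne_top_of_nonneg hb.le hg_top
  have hs₀ : s ≠ 0 := mul_ne_zero (ENNReal.rpow_pos (pos_iff_ne_zero.2 hf₀) hf_top).ne'
    (ENNReal.rpow_pos (pos_iff_ne_zero.2 hg₀) hg_top).ne'
  have hnormalize : ∀ x y : ℝ≥0∞, (F⁻¹ * x) ^ a * (G⁻¹ * y) ^ b = s⁻¹ * (x ^ a * y ^ b) := by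
    intro x y
    rw [ENNReal.mul_rpow_of_nonneg _ _ ha.le, ENNReal.mul_rpow_of_nonneg _ _ hb.le,
      ENNReal.inv_rpow, ENNReal.inv_rpow, hs, ENNReal.mul_inv (Or.inr hGb) (Or.inl hFa),
      mul_mul_mul_comm]
  have h₁ := add_lintegral_le_of_iSup_eq_one (hf.const_mul F⁻¹) (hg.const_mul G⁻¹)
    (hh.const_mul s⁻¹) ha hb hab
    (by rw [← ENNReal.mul_iSup, ENNReal.inv_mul_cancel hf₀ hf_top])
    (by rw [← ENNReal.mul_iSup, ENNReal.inv_mul_cancel hg₀ hg_top])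
    (fun x y => by rw [hnormalize]; exact mul_le_mul_right (hfgh x y) _)
  have h₂ := (rpow_mul_rpow_le_add ha hb hab _ _).trans h₁
  rw [lintegral_const_mul _ hf, lintegral_const_mul _ hg, lintegral_const_mul _ hh,
    hnormalize] at h₂
  exact (ENNReal.mul_le_mul_iff_right (ENNReal.inv_ne_zero.2 (ENNReal.mul_ne_top hFa hGb))
    (ENNReal.inv_ne_top.2 hs₀)).1 h₂

theorem tendsto_lintegral_min_natCast {α : Type*} [MeasurableSpace α] (μ : Measure α)
    {f : α → ℝ≥0∞} (hf : Measurable f) :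
    Tendsto (fun N : ℕ => ∫⁻ x, min (f x) N ∂μ) atTop (𝓝 (∫⁻ x, f x ∂μ)) := by
  refine lintegral_tendsto_of_tendsto_of_monotone
    (fun N => (hf.min measurable_const).aemeasurable)
    (Eventually.of_forall fun x N N' hN => min_le_min_left _ (by exact_mod_cast hN))
    (Eventually.of_forall fun x => ?_)
  simpa only [min_top_right] using
    (tendsto_const_nhds (x := f x)).min ENNReal.tendsto_nat_nhds_top

theorem satisfiesPrekopaLeindler_real : SatisfiesPrekopaLeindler (volume : Measure ℝ) := by
  intro a b ha hb hab f g h hf hg hh hfgh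
  obtain hf₀ | hf₀ := eq_or_ne (∫⁻ x, f x) 0
  · simp [hf₀, ha]
  obtain hg₀ | hg₀ := eq_or_ne (∫⁻ x, g x) 0
  · simp [hg₀, hb]
  have hlim : Tendsto (fun N : ℕ => (∫⁻ x, min (f x) N) ^ a * (∫⁻ x, min (g x) N) ^ b) atTop
      (𝓝 ((∫⁻ x, f x) ^ a * (∫⁻ x, g x) ^ b)) := by
    refine ENNReal.Tendsto.mul ((tendsto_lintegral_min_natCast _ hf).ennrpow_const _) (Or.inl ?_)
      ((tendsto_lintegral_min_natCast _ hg).ennrpow_const _) (Or.inl ?_)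
    · simp [hf₀, ha, not_lt.2 ha.le]
    · simp [hg₀, hb, not_lt.2 hb.le]
  refine le_of_tendsto hlim (Eventually.of_forall fun N => ?_)
  have hbdd : ∀ k : ℝ → ℝ≥0∞, ⨆ x, min (k x) N ≠ ∞ := fun k =>
    ne_top_of_le_ne_top (ENNReal.natCast_ne_top N) (iSup_le fun x => min_le_right _ _)
  refine rpow_lintegral_mul_rpow_lintegral_le_of_bounded (hf.min measurable_const)
    (hg.min measurable_const) hh ha hb hab (hbdd f) (hbdd g) fun x y => le_trans ?_ (hfgh x y)
  gcongr <;> exact min_le_left _ _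

namespace SatisfiesPrekopaLeindler

variable {E F : Type*} [AddCommGroup E] [Module ℝ E] [MeasurableSpace E]
  [AddCommGroup F] [Module ℝ F] [MeasurableSpace F] {μ : Measure E} {ν : Measure F}

theorem prod [SFinite ν] (hμ : SatisfiesPrekopaLeindler μ) (hν : SatisfiesPrekopaLeindler ν) :
    SatisfiesPrekopaLeindler (μ.prod ν) := by
  intro a b ha hb hab f g h hf hg hh hfgh
  rw [lintegral_prod f hf.aemeasurable, lintegral_prod g hg.aemeasurable,
    lintegral_prod h hh.aemeasurable]
  refine hμ ha hb hab hf.lintegral_prod_right' hg.lintegral_prod_right' hh.lintegral_prod_right'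
    fun x x' => hν ha hb hab (hf.comp measurable_prodMk_left) (hg.comp measurable_prodMk_left)
    (hh.comp measurable_prodMk_left) fun y y' => ?_
  simpa only [Prod.smul_mk, Prod.mk_add_mk] using hfgh (x, y) (x', y')

theorem map (hμ : SatisfiesPrekopaLeindler μ) (e : E →ₗ[ℝ] F) (he : Measurable e) :
    SatisfiesPrekopaLeindler (μ.map e) := by
  intro a b ha hb hab f g h hf hg hh hfgh
  rw [lintegral_map hf he, lintegral_map hg he, lintegral_map hh he]
  refine hμ ha hb hab (hf.comp he) (hg.comp he) (hh.comp he) fun x y => ?_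
  simpa only [Function.comp_apply, map_add, map_smul] using hfgh (e x) (e y)

theorem smul (hμ : SatisfiesPrekopaLeindler μ) (c : ℝ≥0∞) :
    SatisfiesPrekopaLeindler (c • μ) := by
  intro a b ha hb hab f g h hf hg hh hfgh
  have hc : c ^ a * c ^ b = c := by
    rw [← ENNReal.rpow_add_of_nonneg _ _ ha.le hb.le, hab, ENNReal.rpow_one]
  simp only [lintegral_smul_measure, smul_eq_mul]
  rw [ENNReal.mul_rpow_of_nonneg _ _ ha.le, ENNReal.mul_rpow_of_nonneg _ _ hb.le,
    mul_mul_mul_comm, hc]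
  exact mul_le_mul_right (hμ ha hb hab hf hg hh hfgh) c

theorem measure_rpow_mul_measure_rpow_le (hμ : SatisfiesPrekopaLeindler μ) {a b : ℝ} (ha : 0 < a)
    (hb : 0 < b) (hab : a + b = 1) {A B C : Set E} (hA : MeasurableSet A) (hB : MeasurableSet B)
    (hC : MeasurableSet C) (hABC : a • A + b • B ⊆ C) : μ A ^ a * μ B ^ b ≤ μ C := by
  have h := hμ ha hb hab (measurable_one.indicator hA) (measurable_one.indicator hB)
    (measurable_one.indicator hC) fun x y => ?_
  · simpa only [lintegral_indicator_one, hA, hB, hC] using h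
  by_cases hx : x ∈ A
  · by_cases hy : y ∈ B
    · have hxy : a • x + b • y ∈ C :=
        hABC (add_mem_add (smul_mem_smul_set hx) (smul_mem_smul_set hy))
      simp [hx, hy, hxy]
    · simp [hy, hb]
  · simp [hx, ha]

end SatisfiesPrekopaLeindler

theorem satisfiesPrekopaLeindler_pi :
    ∀ n : ℕ, SatisfiesPrekopaLeindler (volume : Measure (Fin n → ℝ))
  | 0 => fun a b _ _ _ f g h _ _ _ hfgh => by
    simp only [lintegral_unique, volume_pi, Measure.pi_univ, Finset.univ_eq_empty,
      Finset.prod_empty, mul_one]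
    convert hfgh default default
  | n + 1 => by
    have hprod := satisfiesPrekopaLeindler_real.prod (satisfiesPrekopaLeindler_pi n)
    have hcons := (volume_preserving_piFinSuccAbove (fun _ : Fin (n + 1) => ℝ) 0).symm
    rw [← Measure.volume_eq_prod] at hprod
    have hlinear : ⇑(MeasurableEquiv.piFinSuccAbove (fun _ : Fin (n + 1) => ℝ) 0).symm =
        (Fin.consLinearEquiv ℝ fun _ : Fin (n + 1) => ℝ).toLinearMap := by
      ext p i
      simp [MeasurableEquiv.piFinSuccAbove]
    rw [← hcons.map_eq, hlinear]
    exact hprod.map _ (hlinear ▸ hcons.measurable)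

section AddHaar

variable {E : Type*} [NormedAddCommGroup E] [NormedSpace ℝ E] [FiniteDimensional ℝ E]
  [MeasurableSpace E] [BorelSpace E] (μ : Measure E) [μ.IsAddHaarMeasure]

theorem satisfiesPrekopaLeindler_addHaar : SatisfiesPrekopaLeindler μ := by
  let e : (Fin (Module.finrank ℝ E) → ℝ) ≃L[ℝ] E :=
    ContinuousLinearEquiv.ofFinrankEq (Module.finrank_fin_fun ℝ)
  have : (volume.map e).IsAddHaarMeasure := e.isAddHaarMeasure_map volume
  rw [Measure.isAddLeftInvariant_eq_smul μ (volume.map e)]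
  exact ((satisfiesPrekopaLeindler_pi _).map e.toLinearMap e.continuous.measurable).smul _

variable [Nontrivial E] {A B : Set E}

theorem exists_eq_smul_of_measure_eq_one (hA : IsCompact A) (hA₀ : μ A ≠ 0) :
    ∃ c : ℝ, 0 < c ∧ ∃ A' : Set E, IsCompact A' ∧ μ A' = 1 ∧ A = c • A' ∧
      μ A ^ (Module.finrank ℝ E : ℝ)⁻¹ = ENNReal.ofReal c := by
  have hn : Module.finrank ℝ E ≠ 0 := Module.finrank_pos.ne'
  set c : ℝ := (μ A).toReal ^ (Module.finrank ℝ E : ℝ)⁻¹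
  have hc : 0 < c := Real.rpow_pos_of_pos (ENNReal.toReal_pos hA₀ hA.measure_ne_top) _
  have hμA : μ A = ENNReal.ofReal (c ^ Module.finrank ℝ E) := by
    rw [Real.rpow_inv_natCast_pow ENNReal.toReal_nonneg hn, ENNReal.ofReal_toReal hA.measure_ne_top]
  refine ⟨c, hc, c⁻¹ • A, hA.smul _, ?_, (smul_inv_smul₀ hc.ne' A).symm, ?_⟩
  · rw [Measure.addHaar_smul, hμA, ← ENNReal.ofReal_mul (abs_nonneg _), inv_pow,
      abs_of_pos (by positivity), inv_mul_cancel₀ (by positivity), ENNReal.ofReal_one]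
  · rw [hμA, ENNReal.ofReal_rpow_of_nonneg (by positivity) (by positivity),
      Real.pow_rpow_inv_natCast hc.le hn]

theorem measure_rpow_add_measure_rpow_le (hA : IsCompact A) (hB : IsCompact B)
    (hA_ne : A.Nonempty) (hB_ne : B.Nonempty) :
    μ A ^ (Module.finrank ℝ E : ℝ)⁻¹ + μ B ^ (Module.finrank ℝ E : ℝ)⁻¹ ≤
      μ (A + B) ^ (Module.finrank ℝ E : ℝ)⁻¹ := by
  have hn : 0 < Module.finrank ℝ E := Module.finrank_pos
  have hn' : (0 : ℝ) < (Module.finrank ℝ E : ℝ)⁻¹ := by positivity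
  obtain hA₀ | hA₀ := eq_or_ne (μ A) 0
  · obtain ⟨a, ha⟩ := hA_ne
    rw [hA₀, ENNReal.zero_rpow_of_pos hn', zero_add, ← measure_vadd μ a B]
    exact ENNReal.rpow_le_rpow (measure_mono (vadd_set_subset_add ha)) hn'.le
  obtain hB₀ | hB₀ := eq_or_ne (μ B) 0
  · obtain ⟨b, hb⟩ := hB_ne
    rw [hB₀, ENNReal.zero_rpow_of_pos hn', add_zero, ← measure_vadd μ b A, add_comm A B]
    exact ENNReal.rpow_le_rpow (measure_mono (vadd_set_subset_add hb)) hn'.le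
  -- Normalizing both volumes to one turns the multiplicative inequality into the additive one.
  obtain ⟨s, hs, A', hA', hμA', rfl, hsA⟩ := exists_eq_smul_of_measure_eq_one μ hA hA₀
  obtain ⟨t, ht, B', hB', hμB', rfl, htB⟩ := exists_eq_smul_of_measure_eq_one μ hB hB₀
  set a := s / (s + t)
  set b := t / (s + t)
  have hone : 1 ≤ μ (a • A' + b • B') := by
    have h := (satisfiesPrekopaLeindler_addHaar μ).measure_rpow_mul_measure_rpow_le
      (a := a) (b := b) (by positivity) (by positivity)
      (by rw [← add_div, div_self (by positivity)])
      hA'.measurableSet hB'.measurableSet ((hA'.smul a).add (hB'.smul b)).measurableSet subset_rfl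
    simpa only [hμA', hμB', ENNReal.one_rpow, mul_one] using h
  have hsum : s • A' + t • B' = (s + t) • (a • A' + b • B') := by
    rw [smul_add, smul_smul, smul_smul, mul_div_cancel₀ _ (by positivity),
      mul_div_cancel₀ _ (by positivity)]
  rw [hsA, htB, ← ENNReal.ofReal_add hs.le ht.le, hsum, Measure.addHaar_smul,
    abs_of_pos (by positivity), ENNReal.mul_rpow_of_nonneg _ _ hn'.le,
    ENNReal.ofReal_rpow_of_nonneg (by positivity) hn'.le,
    Real.pow_rpow_inv_natCast (by positivity) hn.ne']
  exact le_mul_of_one_le_right' (ENNReal.one_le_rpow hone hn')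

end AddHaar

end BrunnMinkowski

section AgreeUpTo

theorem euclideanHausdorffMeasure_image_le_of_lipschitzOnWith {X Y : Type*} [MetricSpace X]
    [MeasurableSpace X] [BorelSpace X] [MetricSpace Y] [MeasurableSpace Y] [BorelSpace Y] {C : ℝ≥0}
    {f : X → Y} {s : Set X} (hf : LipschitzOnWith C f s) (d : ℕ) :
    μHE[d] (f '' s) ≤ (C ^ d : ℝ≥0) * μHE[d] s := by
  have h := hf.hausdorffMeasure_image_le (Nat.cast_nonneg d)
  rw [ENNReal.rpow_natCast, ← ENNReal.coe_pow] at h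
  simp only [Measure.euclideanHausdorffMeasure_def, Measure.smul_apply, ENNReal.smul_def,
    smul_eq_mul]
  rw [mul_left_comm]
  gcongr

/-- `x` and `y` agree up to the factor `C`. Applied to `edist (f z) (f w)` and `edist z w` this
says that `f` is bi-Lipschitz with constant `C`. -/
def AgreeUpTo (C : ℝ≥0) (x y : ℝ≥0∞) : Prop :=
  x ≤ C * y ∧ y ≤ C * x

namespace AgreeUpTo

variable {C D : ℝ≥0} {x y z : ℝ≥0∞}

theorem symm (h : AgreeUpTo C x y) : AgreeUpTo C y x :=
  And.symm h

theorem trans (hxy : AgreeUpTo C x y) (hyz : AgreeUpTo D y z) : AgreeUpTo (C * D) x z := by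
  constructor
  · calc x ≤ C * y := hxy.1
      _ ≤ C * (D * z) := by gcongr; exact hyz.1
      _ = (C * D : ℝ≥0) * z := by rw [ENNReal.coe_mul, mul_assoc]
  · calc z ≤ D * y := hyz.2
      _ ≤ D * (C * x) := by gcongr; exact hxy.2
      _ = (C * D : ℝ≥0) * x := by rw [ENNReal.coe_mul, ← mul_assoc, mul_comm (D : ℝ≥0∞)]

theorem mul_left (h : AgreeUpTo C x y) (w : ℝ≥0∞) : AgreeUpTo C (w * x) (w * y) := by
  constructor <;> rw [mul_left_comm] <;> gcongr
  exacts [h.1, h.2]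

theorem inv (h : AgreeUpTo C x y) (hC : C ≠ 0) : AgreeUpTo C x⁻¹ y⁻¹ := by
  have hC₀ : (C : ℝ≥0∞) ≠ 0 := ENNReal.coe_ne_zero.2 hC
  constructor <;>
    rw [← ENNReal.inv_le_inv, inv_inv, ENNReal.mul_inv (.inl hC₀) (.inl ENNReal.coe_ne_top),
      inv_inv, ENNReal.inv_mul_le_iff hC₀ ENNReal.coe_ne_top]
  exacts [h.2, h.1]

theorem setLIntegral_const {α : Type*} [MeasurableSpace α] {μ : Measure α} {s : Set α}
    (hs : MeasurableSet s) {f : α → ℝ≥0∞} (h : ∀ u ∈ s, AgreeUpTo C (f u) x) :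
    AgreeUpTo C (∫⁻ u in s, f u ∂μ) (x * μ s) := by
  rw [← MeasureTheory.setLIntegral_const]
  constructor <;> rw [← lintegral_const_mul' _ _ ENNReal.coe_ne_top]
  exacts [setLIntegral_mono' hs fun u hu => (h u hu).1,
    setLIntegral_mono' hs fun u hu => (h u hu).2]

theorem enorm_of_norm_sub_le {E : Type*} [SeminormedAddCommGroup E] {u v : E} (hC : C ≠ 0)
    (h : ‖u - v‖ ≤ (1 - (C : ℝ)⁻¹) * ‖v‖) : AgreeUpTo C ‖u‖ₑ ‖v‖ₑ := by
  have hC' : (0 : ℝ) < C := NNReal.coe_pos.2 (pos_iff_ne_zero.2 hC)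
  have huv := abs_le.1 ((abs_norm_sub_norm_le u v).trans h)
  have hCC : 2 - (C : ℝ)⁻¹ ≤ C := by
    have : (C : ℝ) + (C : ℝ)⁻¹ - 2 = (C : ℝ)⁻¹ * (C - 1) ^ 2 := by field_simp; ring
    have : 0 ≤ (C : ℝ)⁻¹ * (C - 1) ^ 2 := by positivity
    linarith
  have hu : ‖u‖ ≤ C * ‖v‖ :=
    calc ‖u‖ ≤ (2 - (C : ℝ)⁻¹) * ‖v‖ := by linarith
      _ ≤ C * ‖v‖ := by gcongr
  have hv : ‖v‖ ≤ C * ‖u‖ := by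
    rw [← inv_mul_le_iff₀ hC']
    linarith
  simp only [AgreeUpTo, enorm_eq_nnnorm]
  exact ⟨mod_cast hu, mod_cast hv⟩

theorem injOn {X Y : Type*} [MetricSpace X] [PseudoMetricSpace Y] {f : X → Y} {s : Set X}
    (h : ∀ z ∈ s, ∀ w ∈ s, AgreeUpTo C (edist (f z) (f w)) (edist z w)) : InjOn f s :=
  fun z hz w hw hzw => by simpa [hzw] using (h z hz w hw).2

theorem euclideanHausdorffMeasure_image {X Y : Type*} [MetricSpace X] [MeasurableSpace X]
    [BorelSpace X] [MetricSpace Y] [MeasurableSpace Y] [BorelSpace Y] {f : X → Y} {s : Set X}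
    (h : ∀ z ∈ s, ∀ w ∈ s, AgreeUpTo C (edist (f z) (f w)) (edist z w)) (d : ℕ) :
    AgreeUpTo (C ^ d) (μHE[d] (f '' s)) (μHE[d] s) := by
  obtain _ | _ := isEmpty_or_nonempty X
  · simp [AgreeUpTo, eq_empty_of_isEmpty s]
  have hinj := injOn h
  have hlip : LipschitzOnWith C f s := fun z hz w hw => (h z hz w hw).1
  have hlip_inv : LipschitzOnWith C (Function.invFunOn f s) (f '' s) := by
    rintro _ ⟨z, hz, rfl⟩ _ ⟨w, hw, rfl⟩
    rw [hinj.leftInvOn_invFunOn hz, hinj.leftInvOn_invFunOn hw]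
    exact (h z hz w hw).2
  have hpreimage := euclideanHausdorffMeasure_image_le_of_lipschitzOnWith hlip_inv d
  rw [hinj.leftInvOn_invFunOn.image_image] at hpreimage
  exact ⟨euclideanHausdorffMeasure_image_le_of_lipschitzOnWith hlip d, hpreimage⟩

end AgreeUpTo

theorem le_of_forall_one_lt_le_coe_mul {x y : ℝ≥0∞} (h : ∀ C : ℝ≥0, 1 < C → x ≤ C * y) :
    x ≤ y := by
  have hlim : Tendsto (fun C : ℝ≥0 => (C : ℝ≥0∞) * y) (𝓝[>] 1) (𝓝 (1 * y)) :=
    ENNReal.Tendsto.mul_const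
      ((ENNReal.continuous_coe.tendsto 1).mono_left nhdsWithin_le_nhds) (.inl one_ne_zero)
  rw [one_mul] at hlim
  exact ge_of_tendsto hlim (eventually_mem_nhdsWithin.mono h)

theorem measure_le_of_forall_le_mul_of_small {X : Type*} [PseudoMetricSpace X]
    [SecondCountableTopology X] [MeasurableSpace X] [BorelSpace X] {μ ν : Measure X} {C : ℝ≥0}
    {δ : ℝ} (hδ : 0 < δ) (h : ∀ B, MeasurableSet B → (∀ x ∈ B, ∀ y ∈ B, dist x y ≤ δ) →
      μ B ≤ C * ν B) : μ ≤ C • ν := by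
  obtain _ | _ := isEmpty_or_nonempty X
  · exact (Measure.eq_zero_of_isEmpty μ).le.trans (Measure.zero_le _)
  let D : ℕ → Set X := disjointed fun i => Metric.ball (TopologicalSpace.denseSeq X i) (δ / 2)
  have hDm : ∀ i, MeasurableSet (D i) :=
    MeasurableSet.disjointed fun i => Metric.isOpen_ball.measurableSet
  have hDu : ⋃ i, D i = univ := by
    refine (iUnion_disjointed ..).trans (eq_univ_of_forall fun x => ?_)
    obtain ⟨i, hi⟩ := (TopologicalSpace.denseRange_denseSeq X).exists_dist_lt x (half_pos hδ)
    exact mem_iUnion.2 ⟨i, hi⟩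
  refine Measure.le_iff.2 fun B hB => ?_
  have hsum : ∀ κ : Measure X, κ B = ∑' i, κ (B ∩ D i) := fun κ =>
    by rw [← measure_iUnion (fun i j hij => ((disjoint_disjointed _) hij).mono inter_subset_right
      inter_subset_right) fun i => hB.inter (hDm i), ← inter_iUnion, hDu, inter_univ]
  rw [Measure.smul_apply, ENNReal.smul_def, smul_eq_mul, hsum μ, hsum ν, ← ENNReal.tsum_mul_left]
  refine ENNReal.tsum_le_tsum fun i => h _ (hB.inter (hDm i)) fun x hx y hy => ?_
  have hxi := Metric.mem_ball.1 (disjointed_subset _ i hx.2)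
  have hyi := Metric.mem_ball.1 (disjointed_subset _ i hy.2)
  linarith [dist_triangle_right x y (TopologicalSpace.denseSeq X i)]

theorem measure_eq_of_forall_agreeUpTo_of_small {X : Type*} [PseudoMetricSpace X]
    [SecondCountableTopology X] [MeasurableSpace X] [BorelSpace X] {μ ν : Measure X}
    (h : ∀ C : ℝ≥0, 1 < C → ∃ δ : ℝ, 0 < δ ∧ ∀ B, MeasurableSet B →
      (∀ x ∈ B, ∀ y ∈ B, dist x y ≤ δ) → AgreeUpTo C (μ B) (ν B)) : μ = ν := by
  refine le_antisymm (Measure.le_iff'.2 fun B => le_of_forall_one_lt_le_coe_mul fun C hC => ?_)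
    (Measure.le_iff'.2 fun B => le_of_forall_one_lt_le_coe_mul fun C hC => ?_)
  all_goals obtain ⟨δ, hδ, hagree⟩ := h C hC
  · exact measure_le_of_forall_le_mul_of_small hδ (fun B hB hd => (hagree B hB hd).1) B
  · exact measure_le_of_forall_le_mul_of_small hδ (fun B hB hd => (hagree B hB hd).2) B

end AgreeUpTo

section Cone

variable {V : Type*} [NormedAddCommGroup V] [InnerProductSpace ℝ V] {p : V} {A : Set V}

theorem Ioc_smul_eq_setOf_inner (hA : ∀ x ∈ A, ⟪p, x⟫ = 1) :
    Ioc (0 : ℝ) 1 • A = {z | ⟪p, z⟫ ∈ Ioc (0 : ℝ) 1 ∧ ⟪p, z⟫⁻¹ • z ∈ A} := by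
  ext z
  constructor
  · rintro ⟨s, hs, y, hy, rfl⟩
    simp only [mem_ofPred_eq]
    rw [real_inner_smul_right, hA y hy, mul_one, inv_smul_smul₀ hs.1.ne']
    exact ⟨hs, hy⟩
  · rintro ⟨hs, hy⟩
    exact ⟨_, hs, _, hy, smul_inv_smul₀ hs.1.ne' z⟩

theorem Ioc_smul_inter_setOf_inner_eq (hA : ∀ x ∈ A, ⟪p, x⟫ = 1) {t : ℝ} (ht : t ∈ Ioc (0 : ℝ) 1) :
    Ioc (0 : ℝ) 1 • A ∩ {z | ⟪p, z⟫ = t} = t • A := by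
  ext z
  rw [Ioc_smul_eq_setOf_inner hA, mem_smul_set_iff_inv_smul_mem₀ ht.1.ne']
  constructor
  · rintro ⟨⟨-, hz⟩, rfl⟩
    exact hz
  · intro hz
    have hzt := hA _ hz
    rw [real_inner_smul_right, inv_mul_eq_one₀ ht.1.ne'] at hzt
    subst hzt
    exact ⟨⟨ht, hz⟩, rfl⟩

theorem inner_inv_norm_sq_smul_self (hp : p ≠ 0) : ⟪p, (‖p‖ ^ 2)⁻¹ • p⟫ = 1 := by
  rw [real_inner_smul_right, real_inner_self_eq_norm_sq,
    inv_mul_cancel₀ (pow_ne_zero 2 (norm_ne_zero_iff.2 hp))]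

theorem enorm_inv_norm_sq_smul_self : ‖(‖p‖ ^ 2)⁻¹ • p‖ₑ = ENNReal.ofReal ‖p‖⁻¹ := by
  rw [← ofReal_norm, norm_smul, norm_inv, norm_pow, norm_norm]
  congr 1
  field_simp

theorem mk'_orthogonal_span_singleton_eq_setOf_inner (hp : p ≠ 0) (t : ℝ) :
    (AffineSubspace.mk' (t • (‖p‖ ^ 2)⁻¹ • p +ᵥ (0 : V)) (ℝ ∙ ((‖p‖ ^ 2)⁻¹ • p))ᗮ : Set V) =
      {z | ⟪p, z⟫ = t} := by
  ext z
  rw [SetLike.mem_coe, AffineSubspace.mem_mk', Submodule.mem_orthogonal_singleton_iff_inner_right,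
    vadd_eq_add, add_zero, vsub_eq_sub, real_inner_smul_left, mul_eq_zero, inner_sub_right,
    real_inner_smul_right, inner_inv_norm_sq_smul_self hp, mul_one, sub_eq_zero]
  exact or_iff_right (inv_ne_zero (pow_ne_zero 2 (norm_ne_zero_iff.2 hp)))

theorem setLIntegral_Ioc_ofReal_pow (d : ℕ) :
    ∫⁻ t in Ioc (0 : ℝ) 1, ENNReal.ofReal (t ^ d) = ((d + 1 : ℕ) : ℝ≥0∞)⁻¹ := by
  rw [← ofReal_integral_eq_lintegral_ofReal,
    ← intervalIntegral.integral_of_le zero_le_one, integral_pow, one_pow, zero_pow d.succ_ne_zero,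
    sub_zero, one_div, ENNReal.ofReal_inv_of_pos (by positivity), ← Nat.cast_succ,
    ENNReal.ofReal_natCast]
  · exact ((continuous_pow d).integrableOn_Icc).mono_set Ioc_subset_Icc_self
  · filter_upwards [ae_restrict_mem measurableSet_Ioc] with t ht
    exact pow_nonneg ht.1.le d

variable [MeasurableSpace V] [BorelSpace V]

theorem measurableSet_Ioc_smul (hA : ∀ x ∈ A, ⟪p, x⟫ = 1) (hA_meas : MeasurableSet A) :
    MeasurableSet (Ioc (0 : ℝ) 1 • A) := by
  have hinner : Measurable fun z => ⟪p, z⟫ := (continuous_const.inner continuous_id).measurable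
  rw [Ioc_smul_eq_setOf_inner hA]
  exact (hinner measurableSet_Ioc).inter ((hinner.inv.smul measurable_id) hA_meas)

theorem euclideanHausdorffMeasure_Ioc_smul_inter (hA : ∀ x ∈ A, ⟪p, x⟫ = 1) (d : ℕ) (t : ℝ) :
    μHE[d] (Ioc (0 : ℝ) 1 • A ∩ {z | ⟪p, z⟫ = t}) =
      (Ioc (0 : ℝ) 1).indicator (fun t => ENNReal.ofReal (t ^ d)) t * μHE[d] A := by
  by_cases ht : t ∈ Ioc (0 : ℝ) 1
  · rw [indicator_of_mem ht, Ioc_smul_inter_setOf_inner_eq hA ht,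
      Measure.euclideanHausdorffMeasure_smul₀ _ ht.1.ne', ENNReal.smul_def, smul_eq_mul,
      ENNReal.coe_pow, ENNReal.ofReal_pow ht.1.le, ← enorm_eq_nnnorm,
      Real.enorm_of_nonneg ht.1.le]
  · rw [indicator_of_notMem ht, zero_mul, Ioc_smul_eq_setOf_inner hA]
    convert measure_empty (μ := (μHE[d] : Measure V))
    rw [eq_empty_iff_forall_notMem]
    rintro z ⟨⟨hz, -⟩, rfl⟩
    exact ht hz

theorem finrank_mul_volume_Ioc_smul [FiniteDimensional ℝ V] [Nontrivial V] (hp : p ≠ 0)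
    (hA : ∀ x ∈ A, ⟪p, x⟫ = 1) (hA_meas : MeasurableSet A) :
    (Module.finrank ℝ V : ℝ≥0∞) * volume (Ioc (0 : ℝ) 1 • A) =
      ‖p‖ₑ⁻¹ * μHE[Module.finrank ℝ V - 1] A := by
  have hV : Module.finrank ℝ V ≠ 0 := Module.finrank_pos.ne'
  have hfubini := EuclideanGeometry.euclideanHausdorffMeasure_eq_lintegral (0 : V)
    (smul_ne_zero (inv_ne_zero (pow_ne_zero 2 (norm_ne_zero_iff.2 hp))) hp)
    (measurableSet_Ioc_smul hA hA_meas)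
  simp_rw [mk'_orthogonal_span_singleton_eq_setOf_inner hp,
    euclideanHausdorffMeasure_Ioc_smul_inter hA] at hfubini
  rw [InnerProductSpace.euclideanHausdorffMeasure_eq_volume, lintegral_mul_const _
    (Measurable.indicator (by fun_prop) measurableSet_Ioc), lintegral_indicator measurableSet_Ioc,
    setLIntegral_Ioc_ofReal_pow, enorm_inv_norm_sq_smul_self,
    Nat.sub_add_cancel (Nat.one_le_iff_ne_zero.2 hV)] at hfubini
  rw [hfubini, mul_left_comm, ← mul_assoc _ _ (μHE[_] A),
    ENNReal.mul_inv_cancel (Nat.cast_ne_zero.2 hV) (ENNReal.natCast_ne_top _), one_mul,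
    ENNReal.ofReal_inv_of_pos (norm_pos_iff.2 hp), ofReal_norm]

end Cone

section PolarCoordinates

variable {E : Type*} [NormedAddCommGroup E] [NormedSpace ℝ E] [FiniteDimensional ℝ E]
  [Nontrivial E] [MeasurableSpace E] [BorelSpace E] (μ : Measure E) [μ.IsAddHaarMeasure]

theorem volumeIoiPow_apply_Iic (d : ℕ) (x : Ioi (0 : ℝ)) :
    Measure.volumeIoiPow d (Iic x) = ENNReal.ofReal (x.1 ^ (d + 1) / (d + 1)) := by
  have hx : Measure.volumeIoiPow d {x} = 0 :=
    withDensity_absolutelyContinuous _ _ <| by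
      rw [(MeasurableEmbedding.subtype_coe measurableSet_Ioi).comap_apply,
        image_singleton, measure_singleton]
  rw [← Measure.volumeIoiPow_apply_Iio, measure_congr (Iio_ae_eq_Iic' hx)]

theorem lintegral_eq_lintegral_toSphere {f : E → ℝ≥0∞} (hf : Measurable f) :
    ∫⁻ z, f z ∂μ = ∫⁻ u, ∫⁻ r, f ((r : ℝ) • (u : E))
      ∂Measure.volumeIoiPow (Module.finrank ℝ E - 1) ∂μ.toSphere := by
  have hprod : Measurable fun p : Metric.sphere (0 : E) 1 × Ioi (0 : ℝ) =>
      f ((p.2 : ℝ) • (p.1 : E)) := by fun_prop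
  have hpunctured : ∫⁻ z, f z ∂μ = ∫⁻ z : ({0}ᶜ : Set E), f z ∂μ.comap (↑) := by
    rw [lintegral_subtype_comap (measurableSet_singleton _).compl, restrict_compl_singleton]
  rw [hpunctured, ← lintegral_prod _ hprod.aemeasurable,
    ← μ.measurePreserving_homeomorphUnitSphereProd.lintegral_comp hprod]
  refine lintegral_congr fun z => ?_
  have hz : ‖(z : E)‖ ≠ 0 := norm_ne_zero_iff.2 z.2
  simp [smul_inv_smul₀ hz]

variable {g ρ ψ : E → ℝ} {f : E → ℝ≥0∞}

theorem setLIntegral_setOf_le_eq_lintegral_toSphere (hg : Measurable g) (hρ : Measurable ρ)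
    (hf : Measurable f) (hg_smul : ∀ c : ℝ, 0 < c → ∀ z, g (c • z) = c * g z)
    (hg_pos : ∀ z ≠ 0, 0 < g z)
    (hρ_smul : ∀ c : ℝ, 0 < c → ∀ z, ρ (c • z) = ρ z) (hρ_pos : ∀ z, 0 < ρ z)
    (hf_smul : ∀ c : ℝ, 0 < c → ∀ z, f (c • z) = f z) :
    ∫⁻ z in {z | g z ≤ ρ z}, f z ∂μ =
      ∫⁻ u : Metric.sphere (0 : E) 1, f u * ENNReal.ofReal
        ((ρ u / g u) ^ Module.finrank ℝ E / Module.finrank ℝ E) ∂μ.toSphere := by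
  have hmeas : MeasurableSet {z | g z ≤ ρ z} := measurableSet_le hg hρ
  rw [← lintegral_indicator hmeas, lintegral_eq_lintegral_toSphere μ (hf.indicator hmeas)]
  refine lintegral_congr fun u => ?_
  have hgu := hg_pos u (ne_zero_of_mem_unit_sphere u)
  have hindicator (r : Ioi (0 : ℝ)) : {z | g z ≤ ρ z}.indicator f ((r : ℝ) • (u : E)) =
      (Iic ⟨ρ u / g u, div_pos (hρ_pos u) hgu⟩).indicator (fun _ => f u) r := by
    simp only [indicator, mem_ofPred_eq, mem_Iic, ← Subtype.coe_le_coe, hg_smul _ r.2,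
      hρ_smul _ r.2, hf_smul _ r.2, le_div_iff₀ hgu]
  have hfinrank : Module.finrank ℝ E - 1 + 1 = Module.finrank ℝ E :=
    Nat.sub_add_cancel Module.finrank_pos
  simp only [hindicator]
  rw [lintegral_indicator_const measurableSet_Iic, volumeIoiPow_apply_Iic, ← Nat.cast_succ,
    Nat.succ_eq_add_one, hfinrank]

theorem measure_setOf_le_eq_setLIntegral (hg : Measurable g) (hψ : Measurable ψ)
    (hg_smul : ∀ c : ℝ, 0 < c → ∀ z, g (c • z) = c * g z) (hg_pos : ∀ z ≠ 0, 0 < g z)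
    (hψ_smul : ∀ c : ℝ, 0 < c → ∀ z, ψ (c • z) = ψ z) (hψ_pos : ∀ z, 0 < ψ z) :
    μ {z | g z ≤ ψ z} = ∫⁻ z in {z | g z ≤ 1}, ENNReal.ofReal (ψ z ^ Module.finrank ℝ E) ∂μ := by
  rw [← setLIntegral_one, setLIntegral_setOf_le_eq_lintegral_toSphere μ hg hψ measurable_const
    hg_smul hg_pos hψ_smul hψ_pos fun _ _ _ => rfl,
    setLIntegral_setOf_le_eq_lintegral_toSphere μ hg measurable_const
      (hψ.pow_const _).ennreal_ofReal hg_smul hg_pos (fun _ _ _ => rfl) (fun _ => one_pos)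
      fun c hc z => by rw [hψ_smul c hc]]
  refine lintegral_congr fun u => ?_
  have := hψ_pos u
  rw [one_mul, ← ENNReal.ofReal_mul (by positivity)]
  congr 1
  ring

end PolarCoordinates

section Gradient

variable {V : Type*} [NormedAddCommGroup V] [InnerProductSpace ℝ V] [CompleteSpace V]

theorem eq_gradient_of_forall_inner_sub_le {f : V → ℝ} {z q : V} (hf : DifferentiableAt ℝ f z)
    (hq : ∀ w, ⟪q, w - z⟫ ≤ f w - f z) : q = gradient f z := by
  have hmin : IsLocalMin (fun w => f w - ⟪q, w⟫) z := by
    refine Eventually.of_forall fun w => ?_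
    have := hq w
    rw [inner_sub_right] at this
    linarith
  have hderiv : HasFDerivAt (fun w => f w - ⟪q, w⟫)
      (fderiv ℝ f z - InnerProductSpace.toDual ℝ V q) z :=
    hf.hasFDerivAt.sub (InnerProductSpace.toDual ℝ V q).hasFDerivAt
  rw [gradient, sub_eq_zero.1 (hmin.hasFDerivAt_eq_zero hderiv),
    LinearIsometryEquiv.symm_apply_apply]

theorem gradient_smul_of_map_smul {f : V → ℝ} {c : ℝ} (hc : c ≠ 0) (hf : ∀ w, f (c • w) = c * f w)
    (z : V) : gradient f (c • z) = gradient f z := by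
  have hfc : f = c⁻¹ • fun w => f (c • w) := by
    funext w
    rw [Pi.smul_apply, hf, smul_eq_mul, inv_mul_cancel_left₀ hc]
  have hfderiv : fderiv ℝ f z = fderiv ℝ f (c • z) := by
    conv_lhs => rw [hfc]
    rw [fderiv_const_smul_field, Pi.smul_apply, fderiv_comp_smul, smul_smul,
      inv_mul_cancel₀ hc, one_smul]
  rw [gradient, gradient, hfderiv]

theorem measurable_gradient [MeasurableSpace V] [BorelSpace V] (f : V → ℝ) :
    Measurable (gradient f) :=
  (InnerProductSpace.toDual ℝ V).symm.continuous.measurable.comp (measurable_fderiv ℝ f)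

end Gradient

variable {n : ℕ}

local notation "𝔼" => EuclideanSpace ℝ (Fin n)

local notation "𝕊" => Metric.sphere (0 : EuclideanSpace ℝ (Fin n)) 1

section SupportFun

variable {K : ConvexBody (EuclideanSpace ℝ (Fin n))}

theorem inner_le_supportFun (K : ConvexBody 𝔼) {x : 𝔼} (hx : x ∈ K) (u : 𝔼) :
    ⟪u, x⟫ ≤ supportFun K u :=
  le_csSup (K.isCompact.image (f := fun y => ⟪u, y⟫) (by fun_prop)).bddAbove ⟨x, hx, rfl⟩

theorem supportFun_le (K : ConvexBody 𝔼) {u : 𝔼} {c : ℝ} (h : ∀ x ∈ K, ⟪u, x⟫ ≤ c) :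
    supportFun K u ≤ c := by
  refine csSup_le (K.nonempty.image _) ?_
  rintro _ ⟨x, hx, rfl⟩
  exact h x hx

theorem exists_inner_eq_supportFun (K : ConvexBody 𝔼) (u : 𝔼) :
    ∃ x ∈ K, ⟪u, x⟫ = supportFun K u := by
  obtain ⟨x, hx, hmax⟩ := K.isCompact.exists_isMaxOn K.nonempty (f := fun y => ⟪u, y⟫)
    (by fun_prop)
  exact ⟨x, hx, le_antisymm (inner_le_supportFun K hx u) (supportFun_le K fun y hy => hmax hy)⟩

theorem supportFun_smul (K : ConvexBody 𝔼) {c : ℝ} (hc : 0 ≤ c) (u : 𝔼) :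
    supportFun K (c • u) = c * supportFun K u := by
  obtain ⟨x, hx, hxu⟩ := exists_inner_eq_supportFun K u
  refine le_antisymm (supportFun_le K fun y hy => ?_) ?_
  · rw [real_inner_smul_left]
    exact mul_le_mul_of_nonneg_left (inner_le_supportFun K hy u) hc
  · rw [← hxu, ← real_inner_smul_left]
    exact inner_le_supportFun K hx _

theorem supportFun_zero (K : ConvexBody 𝔼) : supportFun K (0 : 𝔼) = 0 := by
  simpa using supportFun_smul K le_rfl (0 : 𝔼)

theorem supportFun_smul_set (K : ConvexBody 𝔼) {c : ℝ} (hc : 0 ≤ c) (u : 𝔼) :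
    supportFun (c • (K : Set 𝔼)) u = c * supportFun K u := by
  rw [← supportFun_smul K hc, supportFun, supportFun, ← image_smul, image_image]
  simp only [real_inner_smul_left, real_inner_smul_right]

theorem exists_pos_subset_closedBall (K : ConvexBody 𝔼) :
    ∃ R : ℝ, 0 < R ∧ (K : Set 𝔼) ⊆ Metric.closedBall 0 R := by
  obtain ⟨R, hKR⟩ := K.isBounded.subset_closedBall 0
  exact ⟨max R 1, by positivity, hKR.trans (Metric.closedBall_subset_closedBall (le_max_left _ _))⟩

theorem supportFun_le_add (K : ConvexBody 𝔼) {R : ℝ} (hKR : (K : Set 𝔼) ⊆ Metric.closedBall 0 R)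
    (u w : 𝔼) : supportFun K u ≤ supportFun K w + R * ‖u - w‖ := by
  refine supportFun_le K fun x hx => ?_
  have hxR : ‖x‖ ≤ R := by simpa using hKR hx
  calc ⟪u, x⟫ = ⟪w, x⟫ + ⟪u - w, x⟫ := by rw [inner_sub_left]; ring
    _ ≤ supportFun K w + ‖u - w‖ * ‖x‖ :=
      add_le_add (inner_le_supportFun K hx w) (real_inner_le_norm _ _)
    _ ≤ supportFun K w + R * ‖u - w‖ := by rw [mul_comm]; gcongr

theorem supportFun_le_mul_norm (K : ConvexBody 𝔼) {R : ℝ}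
    (hKR : (K : Set 𝔼) ⊆ Metric.closedBall 0 R) (u : 𝔼) : supportFun K u ≤ R * ‖u‖ := by
  simpa [supportFun_zero] using supportFun_le_add K hKR u 0

theorem continuous_supportFun (K : ConvexBody 𝔼) : Continuous (supportFun (K : Set 𝔼)) := by
  obtain ⟨R, -, hKR⟩ := exists_pos_subset_closedBall K
  refine (LipschitzWith.of_le_add_mul' R fun u w => ?_).continuous
  rw [dist_eq_norm]
  exact supportFun_le_add K hKR u w

theorem supportFun_pos (hK : (0 : 𝔼) ∈ interior (K : Set 𝔼)) {u : 𝔼} (hu : u ≠ 0) :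
    0 < supportFun K u := by
  obtain ⟨r, hr, hrK⟩ := Metric.nhds_basis_closedBall.mem_iff.1 (mem_interior_iff_mem_nhds.1 hK)
  have hu' := norm_pos_iff.2 hu
  have hmem : (r / ‖u‖) • u ∈ K := hrK <| by simp [norm_smul, abs_of_pos hr, hu'.ne']
  refine lt_of_lt_of_le ?_ (inner_le_supportFun K hmem u)
  rw [real_inner_smul_right, real_inner_self_eq_norm_sq]
  positivity

theorem supportFun_nonneg (hK : (0 : 𝔼) ∈ interior (K : Set 𝔼)) (u : 𝔼) : 0 ≤ supportFun K u := by
  simpa using inner_le_supportFun K (interior_subset hK) u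

end SupportFun

section Gauge

variable {K : ConvexBody (EuclideanSpace ℝ (Fin n))}

theorem gauge_le_one_iff (hK : (0 : 𝔼) ∈ interior (K : Set 𝔼)) {x : 𝔼} :
    gauge (K : Set 𝔼) x ≤ 1 ↔ x ∈ K := by
  rw [gauge_le_one_iff_mem_closure K.convex (mem_interior_iff_mem_nhds.1 hK),
    K.isClosed.closure_eq, SetLike.mem_coe]

theorem gauge_smul_eq (K : ConvexBody 𝔼) {c : ℝ} (hc : 0 ≤ c) (x : 𝔼) :
    gauge (K : Set 𝔼) (c • x) = c * gauge (K : Set 𝔼) x := by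
  rw [gauge_smul_of_nonneg hc, smul_eq_mul]

theorem gauge_pos_iff (hK : (0 : 𝔼) ∈ interior (K : Set 𝔼)) {x : 𝔼} :
    0 < gauge (K : Set 𝔼) x ↔ x ≠ 0 :=
  gauge_pos (absorbent_nhds_zero (mem_interior_iff_mem_nhds.1 hK))
    ((NormedSpace.isVonNBounded_iff ℝ).2 K.isBounded)

theorem gauge_eq_one_iff (hK : (0 : 𝔼) ∈ interior (K : Set 𝔼)) {x : 𝔼} :
    gauge (K : Set 𝔼) x = 1 ↔ x ∈ frontier (K : Set 𝔼) :=
  gauge_eq_one_iff_mem_frontier K.convex (mem_interior_iff_mem_nhds.1 hK)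

theorem gauge_inv_gauge_smul (hK : (0 : 𝔼) ∈ interior (K : Set 𝔼)) {x : 𝔼} (hx : x ≠ 0) :
    gauge (K : Set 𝔼) ((gauge (K : Set 𝔼) x)⁻¹ • x) = 1 := by
  rw [gauge_smul_eq K (inv_nonneg.2 (gauge_nonneg x)),
    inv_mul_cancel₀ ((gauge_pos_iff hK).2 hx).ne']

theorem inner_le_supportFun_mul_gauge (hK : (0 : 𝔼) ∈ interior (K : Set 𝔼)) (u x : 𝔼) :
    ⟪u, x⟫ ≤ supportFun K u * gauge (K : Set 𝔼) x := by
  obtain rfl | hx := eq_or_ne x 0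
  · simp
  have hmem := (gauge_le_one_iff hK).1 (gauge_inv_gauge_smul hK hx).le
  have hle := inner_le_supportFun K hmem u
  rwa [real_inner_smul_right, inv_mul_le_iff₀ ((gauge_pos_iff hK).2 hx), mul_comm] at hle

theorem continuous_gauge_of_zero_mem_interior (hK : (0 : 𝔼) ∈ interior (K : Set 𝔼)) :
    Continuous (gauge (K : Set 𝔼)) :=
  continuous_gauge K.convex (mem_interior_iff_mem_nhds.1 hK)

theorem exists_lipschitzWith_gauge (hK : (0 : 𝔼) ∈ interior (K : Set 𝔼)) :
    ∃ C, LipschitzWith C (gauge (K : Set 𝔼)) :=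
  K.convex.lipschitz_gauge (mem_interior_iff_mem_nhds.1 hK)

theorem ae_differentiableAt_gauge (hK : (0 : 𝔼) ∈ interior (K : Set 𝔼)) :
    ∀ᵐ z, DifferentiableAt ℝ (gauge (K : Set 𝔼)) z :=
  let ⟨_, hC⟩ := exists_lipschitzWith_gauge hK
  hC.ae_differentiableAt

theorem gradient_gauge_smul (K : ConvexBody 𝔼) {c : ℝ} (hc : 0 < c) (z : 𝔼) :
    gradient (gauge (K : Set 𝔼)) (c • z) = gradient (gauge (K : Set 𝔼)) z :=
  gradient_smul_of_map_smul hc.ne' (gauge_smul_eq K hc.le) z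

end Gauge

section PolarPoint

variable {K : ConvexBody (EuclideanSpace ℝ (Fin n))}

/-- The boundary point of the polar body of `K` in direction `u`. It equals the gradient of the
gauge of `K` along the rays through the boundary points of `K` with outer normal `u`. -/
noncomputable def polarPoint (K : Set 𝔼) (u : 𝕊) : 𝔼 :=
  (supportFun K u)⁻¹ • (u : 𝔼)

theorem supportFun_coe_sphere_pos (hK : (0 : 𝔼) ∈ interior (K : Set 𝔼)) (u : 𝕊) :
    0 < supportFun K (u : 𝔼) :=
  supportFun_pos hK (ne_zero_of_mem_unit_sphere u)

theorem supportFun_polarPoint (hK : (0 : 𝔼) ∈ interior (K : Set 𝔼)) (M : ConvexBody 𝔼) (u : 𝕊) :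
    supportFun M (polarPoint K u) = supportFun M (u : 𝔼) / supportFun K (u : 𝔼) := by
  rw [polarPoint, supportFun_smul M (inv_nonneg.2 (supportFun_nonneg hK u)), div_eq_inv_mul]

theorem inner_polarPoint_le_gauge (hK : (0 : 𝔼) ∈ interior (K : Set 𝔼)) (u : 𝕊) (x : 𝔼) :
    ⟪polarPoint K u, x⟫ ≤ gauge (K : Set 𝔼) x := by
  rw [polarPoint, real_inner_smul_left, inv_mul_le_iff₀ (supportFun_coe_sphere_pos hK u)]
  exact inner_le_supportFun_mul_gauge hK u x

theorem norm_polarPoint (hK : (0 : 𝔼) ∈ interior (K : Set 𝔼)) (u : 𝕊) :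
    ‖polarPoint K u‖ = (supportFun K (u : 𝔼))⁻¹ := by
  rw [polarPoint, norm_smul, norm_eq_of_mem_sphere u, mul_one, Real.norm_eq_abs,
    abs_of_nonneg (inv_nonneg.2 (supportFun_nonneg hK _))]

theorem polarPoint_injective (hK : (0 : 𝔼) ∈ interior (K : Set 𝔼)) :
    Function.Injective (polarPoint (K : Set 𝔼)) := by
  intro u w huw
  have hsupport : supportFun K (u : 𝔼) = supportFun K (w : 𝔼) := by
    rw [← inv_inj, ← norm_polarPoint hK, ← norm_polarPoint hK, huw]
  rw [polarPoint, polarPoint, hsupport] at huw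
  exact Subtype.ext
    (smul_right_injective _ (inv_ne_zero (supportFun_coe_sphere_pos hK w).ne') huw)

theorem continuous_polarPoint (hK : (0 : 𝔼) ∈ interior (K : Set 𝔼)) :
    Continuous (polarPoint (K : Set 𝔼)) :=
  (((continuous_supportFun K).comp continuous_subtype_val).inv₀ fun u =>
    (supportFun_coe_sphere_pos hK u).ne').smul continuous_subtype_val

theorem isOuterNormal_iff_inner_polarPoint (hK : (0 : 𝔼) ∈ interior (K : Set 𝔼)) (x : 𝔼) (u : 𝕊) :
    IsOuterNormal K x u ↔ ⟪polarPoint K u, x⟫ = 1 := by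
  rw [IsOuterNormal, polarPoint, real_inner_smul_left, real_inner_comm,
    inv_mul_eq_one₀ (supportFun_coe_sphere_pos hK u).ne', eq_comm]

theorem inner_polarPoint_gaussMap_smul (hK : (0 : 𝔼) ∈ interior (K : Set 𝔼))
    (x : regularBoundary (K : Set 𝔼)) {s : ℝ} (hs : 0 ≤ s) :
    ⟪polarPoint K (gaussMap K x), s • (x : 𝔼)⟫ = gauge (K : Set 𝔼) (s • (x : 𝔼)) := by
  rw [real_inner_smul_right, gauge_smul_eq K hs, (gauge_eq_one_iff hK).2 x.2.1,
    (isOuterNormal_iff_inner_polarPoint hK _ _).1 (isOuterNormal_gaussMap _ x)]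

theorem exists_isOuterNormal (hK : (0 : 𝔼) ∈ interior (K : Set 𝔼)) {x : 𝔼}
    (hx : x ∈ frontier (K : Set 𝔼)) : ∃ u, IsOuterNormal (K : Set 𝔼) x u := by
  obtain ⟨f, hf⟩ := geometric_hahn_banach_open_point K.convex.interior isOpen_interior hx.2
  obtain ⟨v, rfl⟩ := (InnerProductSpace.toDual ℝ 𝔼).surjective f
  simp only [InnerProductSpace.toDual_apply_apply] at hf
  have hv : v ≠ 0 := by
    rintro rfl
    simpa using hf 0 hK
  have hsupporting : (K : Set 𝔼) ⊆ {y | ⟪v, y⟫ ≤ ⟪v, x⟫} := by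
    rw [← K.isClosed.closure_eq,
      ← K.convex.closure_interior_eq_closure_of_nonempty_interior ⟨0, hK⟩]
    exact closure_minimal (fun y hy => (hf y hy).le) (isClosed_le (by fun_prop) (by fun_prop))
  have hv' := norm_pos_iff.2 hv
  refine ⟨⟨‖v‖⁻¹ • v, by simp [norm_smul, hv'.ne']⟩, (isOuterNormal_iff K hx _).2 fun y hy => ?_⟩
  simp only [real_inner_smul_left]
  exact mul_le_mul_of_nonneg_left (hsupporting hy) (by positivity)

theorem polarPoint_eq_gradient_gauge {z : 𝔼} (hK : (0 : 𝔼) ∈ interior (K : Set 𝔼))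
    (hdiff : DifferentiableAt ℝ (gauge (K : Set 𝔼)) z) {u : 𝕊}
    (hu : ⟪polarPoint K u, z⟫ = gauge (K : Set 𝔼) z) :
    polarPoint K u = gradient (gauge (K : Set 𝔼)) z := by
  refine eq_gradient_of_forall_inner_sub_le hdiff fun w => ?_
  rw [inner_sub_right, hu]
  exact sub_le_sub_right (inner_polarPoint_le_gauge hK u w) _

theorem inner_polarPoint_eq_gauge {z : 𝔼} (hK : (0 : 𝔼) ∈ interior (K : Set 𝔼)) (hz : z ≠ 0)
    {u : 𝕊} (hu : IsOuterNormal K ((gauge (K : Set 𝔼) z)⁻¹ • z) u) :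
    ⟪polarPoint K u, z⟫ = gauge (K : Set 𝔼) z := by
  rwa [isOuterNormal_iff_inner_polarPoint hK, real_inner_smul_right,
    inv_mul_eq_one₀ ((gauge_pos_iff hK).2 hz).ne', eq_comm] at hu

theorem inv_gauge_smul_mem_regularBoundary (hK : (0 : 𝔼) ∈ interior (K : Set 𝔼)) {z : 𝔼}
    (hz : z ≠ 0) (hdiff : DifferentiableAt ℝ (gauge (K : Set 𝔼)) z) :
    (gauge (K : Set 𝔼) z)⁻¹ • z ∈ regularBoundary (K : Set 𝔼) := by
  have hx := (gauge_eq_one_iff hK).1 (gauge_inv_gauge_smul hK hz)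
  have heq {u : 𝕊} (hu : IsOuterNormal K ((gauge (K : Set 𝔼) z)⁻¹ • z) u) :=
    polarPoint_eq_gradient_gauge hK hdiff (inner_polarPoint_eq_gauge hK hz hu)
  obtain ⟨u, hu⟩ := exists_isOuterNormal hK hx
  exact ⟨hx, u, hu, fun w hw => polarPoint_injective hK ((heq hw).trans (heq hu).symm)⟩

end PolarPoint

section SupportRatio

variable {K M : ConvexBody (EuclideanSpace ℝ (Fin n))}

theorem exists_polarPoint_eq_gradient_gauge (hK : (0 : 𝔼) ∈ interior (K : Set 𝔼)) {z : 𝔼}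
    (hz : z ≠ 0) (hdiff : DifferentiableAt ℝ (gauge (K : Set 𝔼)) z) :
    ∃ u, polarPoint K u = gradient (gauge (K : Set 𝔼)) z ∧
      ⟪polarPoint K u, z⟫ = gauge (K : Set 𝔼) z := by
  obtain ⟨-, u, hu, -⟩ := inv_gauge_smul_mem_regularBoundary hK hz hdiff
  have hinner := inner_polarPoint_eq_gauge hK hz hu
  exact ⟨u, polarPoint_eq_gradient_gauge hK hdiff hinner, hinner⟩

/-- The ratio `h_M(u) / h_K(u)` of support functions, as a function of a point `z` of the cone over
the boundary points of `K` with outer normal `u`; compare `supportFun_polarPoint`. -/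
noncomputable def supportRatio (K M : Set 𝔼) (z : 𝔼) : ℝ :=
  supportFun M (gradient (gauge K) z)

theorem supportRatio_smul (K : ConvexBody 𝔼) (M : Set 𝔼) {c : ℝ} (hc : 0 < c) (z : 𝔼) :
    supportRatio K M (c • z) = supportRatio K M z := by
  rw [supportRatio, supportRatio, gradient_gauge_smul K hc]

theorem measurable_supportRatio (K : Set 𝔼) (M : ConvexBody 𝔼) :
    Measurable (supportRatio K M) :=
  (continuous_supportFun M).measurable.comp (measurable_gradient _)

theorem exists_ae_supportRatio_mem_Icc [NeZero n] (hK : (0 : 𝔼) ∈ interior (K : Set 𝔼))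
    (hM : (0 : 𝔼) ∈ interior (M : Set 𝔼)) :
    ∃ a b : ℝ, 0 < a ∧ ∀ᵐ z : 𝔼, supportRatio K M z ∈ Icc a b := by
  have : Nonempty 𝕊 := (NormedSpace.sphere_nonempty.2 zero_le_one).to_subtype
  have hcompact : IsCompact (range fun u : 𝕊 => supportFun M (polarPoint (K : Set 𝔼) u)) :=
    isCompact_range ((continuous_supportFun M).comp (continuous_polarPoint hK))
  obtain ⟨a, ⟨v, hv⟩, ha⟩ := hcompact.exists_isLeast (range_nonempty _)
  obtain ⟨b, -, hb⟩ := hcompact.exists_isGreatest (range_nonempty _)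
  refine ⟨a, b, ?_, ?_⟩
  · rw [← hv]
    simp only [supportFun_polarPoint hK]
    exact div_pos (supportFun_coe_sphere_pos hM v) (supportFun_coe_sphere_pos hK v)
  · filter_upwards [ae_differentiableAt_gauge hK, Measure.ae_ne volume (0 : 𝔼)] with z hdiff hz
    obtain ⟨u, hu, -⟩ := exists_polarPoint_eq_gradient_gauge hK hz hdiff
    rw [supportRatio, ← hu]
    exact ⟨ha ⟨u, rfl⟩, hb ⟨u, rfl⟩⟩

theorem measurable_comp_supportFun (hM : (0 : 𝔼) ∈ interior (M : Set 𝔼)) {φ : ℝ → ℝ}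
    (hφ : ContinuousOn φ (Ioi 0)) : Measurable fun u : 𝔼 => φ (supportFun M u) :=
  measurable_of_continuousOn_compl_singleton 0 <|
    hφ.comp (continuous_supportFun M).continuousOn fun _ hu => supportFun_pos hM hu

theorem integrableOn_comp_supportRatio [NeZero n] (hK : (0 : 𝔼) ∈ interior (K : Set 𝔼))
    (hM : (0 : 𝔼) ∈ interior (M : Set 𝔼)) {φ : ℝ → ℝ} (hφ : ContinuousOn φ (Ioi 0)) :
    IntegrableOn (fun z : 𝔼 => φ (supportRatio K M z)) K := by
  obtain ⟨a, b, ha, hmem⟩ := exists_ae_supportRatio_mem_Icc hK hM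
  obtain ⟨C, hC⟩ := isCompact_Icc.exists_bound_of_continuousOn
    (hφ.mono fun x (hx : x ∈ Icc a b) => ha.trans_le hx.1)
  exact IntegrableOn.of_bound K.isCompact.measure_lt_top
    ((measurable_comp_supportFun hM hφ).comp (measurable_gradient _)).aestronglyMeasurable C
    (ae_restrict_of_ae (hmem.mono fun z hz => hC _ hz))

theorem integrableOn_supportRatio [NeZero n] (hK : (0 : 𝔼) ∈ interior (K : Set 𝔼))
    (hM : (0 : 𝔼) ∈ interior (M : Set 𝔼)) : IntegrableOn (supportRatio (K : Set 𝔼) M) K :=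
  integrableOn_comp_supportRatio hK hM continuousOn_id

end SupportRatio

section ConeMeasure

variable {K M : ConvexBody (EuclideanSpace ℝ (Fin n))} {B : Set (EuclideanSpace ℝ (Fin n))}

/-- The measure `h_K dS(K, ·)`, transported from the sphere to the boundary of the polar body. -/
noncomputable def polarSurfaceMeasure (K : Set 𝔼) : Measure 𝔼 :=
  ((surfaceAreaMeasure K).withDensity fun u => ENNReal.ofReal (supportFun K u)).map (polarPoint K)

/-- The cone-volume measure of `K`, transported to the boundary of the polar body: the image of the
volume measure on `K` under the gradient of the gauge. -/
noncomputable def gradientMeasure (K : Set 𝔼) : Measure 𝔼 :=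
  (volume.restrict K).map (gradient (gauge K))

/-- The regular boundary points of `K` whose outer normal `u` satisfies `polarPoint K u ∈ B`. -/
def boundaryPart (K B : Set 𝔼) : Set 𝔼 :=
  Subtype.val '' (gaussMap K ⁻¹' (polarPoint K ⁻¹' B))

theorem measurableSet_boundaryPart (hK : (0 : 𝔼) ∈ interior (K : Set 𝔼)) (hB : MeasurableSet B) :
    MeasurableSet (boundaryPart K B) :=
  (measurableSet_regularBoundary K).subtype_image
    ((continuous_gaussMap K).measurable ((continuous_polarPoint hK).measurable hB))

theorem surfaceAreaMeasure_preimage_polarPoint (hK : (0 : 𝔼) ∈ interior (K : Set 𝔼))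
    (hB : MeasurableSet B) :
    surfaceAreaMeasure (K : Set 𝔼) (polarPoint K ⁻¹' B) = μHE[n - 1] (boundaryPart K B) :=
  surfaceAreaMeasure_apply K ((continuous_polarPoint hK).measurable hB)

theorem polarSurfaceMeasure_apply (hK : (0 : 𝔼) ∈ interior (K : Set 𝔼)) (hB : MeasurableSet B) :
    polarSurfaceMeasure K B = ∫⁻ u in polarPoint K ⁻¹' B,
      ENNReal.ofReal (supportFun K (u : 𝔼)) ∂surfaceAreaMeasure (K : Set 𝔼) := by
  have hpolar := (continuous_polarPoint hK).measurable
  rw [polarSurfaceMeasure, Measure.map_apply hpolar hB, withDensity_apply _ (hpolar hB)]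

theorem gauge_eq_one_of_mem_boundaryPart (hK : (0 : 𝔼) ∈ interior (K : Set 𝔼)) {x : 𝔼}
    (hx : x ∈ boundaryPart K B) : gauge (K : Set 𝔼) x = 1 := by
  obtain ⟨y, -, rfl⟩ := hx
  exact (gauge_eq_one_iff hK).2 y.2.1

theorem exists_polarPoint_mem_of_mem_Ioc_smul (hK : (0 : 𝔼) ∈ interior (K : Set 𝔼)) {z : 𝔼}
    (hz : z ∈ Ioc (0 : ℝ) 1 • boundaryPart K B) :
    ∃ u, polarPoint K u ∈ B ∧ ⟪polarPoint K u, z⟫ = gauge (K : Set 𝔼) z := by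
  obtain ⟨s, hs, _, ⟨x, hx, rfl⟩, rfl⟩ := hz
  exact ⟨gaussMap K x, hx, inner_polarPoint_gaussMap_smul hK x hs.1.le⟩

theorem mem_Ioc_smul_boundaryPart_iff (hK : (0 : 𝔼) ∈ interior (K : Set 𝔼)) {z : 𝔼} (hz : z ≠ 0)
    (hdiff : DifferentiableAt ℝ (gauge (K : Set 𝔼)) z) :
    z ∈ Ioc (0 : ℝ) 1 • boundaryPart K B ↔ gradient (gauge (K : Set 𝔼)) z ∈ B ∧ z ∈ K := by
  have hg := (gauge_pos_iff hK).2 hz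
  constructor
  · intro hzB
    obtain ⟨u, huB, hu⟩ := exists_polarPoint_mem_of_mem_Ioc_smul hK hzB
    refine ⟨polarPoint_eq_gradient_gauge hK hdiff hu ▸ huB, (gauge_le_one_iff hK).1 ?_⟩
    obtain ⟨s, hs, x, hx, rfl⟩ := hzB
    simpa [gauge_smul_eq K hs.1.le, gauge_eq_one_of_mem_boundaryPart hK hx] using hs.2
  · rintro ⟨hzB, hzK⟩
    have hreg := inv_gauge_smul_mem_regularBoundary hK hz hdiff
    have hpolar := polarPoint_eq_gradient_gauge hK hdiff
      (inner_polarPoint_eq_gauge hK hz (isOuterNormal_gaussMap _ ⟨_, hreg⟩))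
    refine ⟨_, ⟨hg, (gauge_le_one_iff hK).2 hzK⟩, _, ⟨⟨_, hreg⟩, ?_, rfl⟩, smul_inv_smul₀ hg.ne' z⟩
    rwa [mem_preimage, mem_preimage, hpolar]

theorem gradientMeasure_apply [NeZero n] (hK : (0 : 𝔼) ∈ interior (K : Set 𝔼))
    (hB : MeasurableSet B) :
    gradientMeasure K B = volume (Ioc (0 : ℝ) 1 • boundaryPart K B) := by
  rw [gradientMeasure, Measure.map_apply (measurable_gradient _) hB,
    Measure.restrict_apply (measurable_gradient _ hB)]
  refine measure_congr ?_
  filter_upwards [ae_differentiableAt_gauge hK, Measure.ae_ne volume (0 : 𝔼)] with z hdiff hz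
  exact propext (mem_Ioc_smul_boundaryPart_iff hK hz hdiff).symm

/-- Moves `z` in the direction `p` to the level of the function `⟪p, ·⟫` given by its gauge. This
maps boundary points of `K` into the hyperplane `⟪p, ·⟫ = 1`, and cones to cones. -/
noncomputable def flatten (K : Set 𝔼) (p z : 𝔼) : 𝔼 :=
  z + (gauge K z - ⟪p, z⟫) • (‖p‖ ^ 2)⁻¹ • p

theorem continuous_flatten (hK : (0 : 𝔼) ∈ interior (K : Set 𝔼)) (p : 𝔼) :
    Continuous (flatten K p) := by
  have := continuous_gauge_of_zero_mem_interior hK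
  unfold flatten
  fun_prop

theorem inner_flatten (K : Set 𝔼) {p : 𝔼} (hp : p ≠ 0) (z : 𝔼) :
    ⟪p, flatten K p z⟫ = gauge K z := by
  rw [flatten, inner_add_right, real_inner_smul_right, inner_inv_norm_sq_smul_self hp]
  ring

theorem flatten_smul (K : ConvexBody 𝔼) (p : 𝔼) {c : ℝ} (hc : 0 ≤ c) (z : 𝔼) :
    flatten K p (c • z) = c • flatten K p z := by
  rw [flatten, flatten, gauge_smul_eq K hc, real_inner_smul_right]
  module

theorem image_flatten_Ioc_smul (K : ConvexBody 𝔼) (p : 𝔼) (A : Set 𝔼) :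
    flatten K p '' (Ioc (0 : ℝ) 1 • A) = Ioc (0 : ℝ) 1 • (flatten K p '' A) := by
  ext z
  constructor
  · rintro ⟨_, ⟨s, hs, x, hx, rfl⟩, rfl⟩
    exact ⟨s, hs, _, mem_image_of_mem _ hx, (flatten_smul K p hs.1.le x).symm⟩
  · rintro ⟨s, hs, _, ⟨x, hx, rfl⟩, rfl⟩
    exact ⟨s • x, smul_mem_smul hs hx, flatten_smul K p hs.1.le x⟩

theorem norm_flatten_sub_flatten_sub_le (hK : (0 : 𝔼) ∈ interior (K : Set 𝔼)) {p z w : 𝔼}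
    (hp : p ≠ 0) {ε : ℝ} {u v : 𝕊} (hu : ‖polarPoint K u - p‖ ≤ ε * ‖p‖)
    (hv : ‖polarPoint K v - p‖ ≤ ε * ‖p‖) (huz : ⟪polarPoint K u, z⟫ = gauge (K : Set 𝔼) z)
    (hvw : ⟪polarPoint K v, w⟫ = gauge (K : Set 𝔼) w) :
    ‖flatten K p z - flatten K p w - (z - w)‖ ≤ ε * ‖z - w‖ := by
  have hdiff : flatten K p z - flatten K p w - (z - w) =
      (gauge (K : Set 𝔼) z - gauge (K : Set 𝔼) w - ⟪p, z - w⟫) • (‖p‖ ^ 2)⁻¹ • p := by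
    rw [flatten, flatten, inner_sub_right]
    module
  have hinner {q : 𝔼} (hq : ‖q - p‖ ≤ ε * ‖p‖) : |⟪q - p, z - w⟫| ≤ ε * ‖p‖ * ‖z - w‖ :=
    (abs_real_inner_le_norm _ _).trans (by gcongr)
  have hlevel : |gauge (K : Set 𝔼) z - gauge (K : Set 𝔼) w - ⟪p, z - w⟫| ≤ ε * ‖p‖ * ‖z - w‖ := by
    have hupper := (le_abs_self _).trans (hinner hu)
    have hlower := (abs_le.1 (hinner hv)).1
    have huw := inner_polarPoint_le_gauge hK u w
    have hvz := inner_polarPoint_le_gauge hK v z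
    simp only [inner_sub_left, inner_sub_right] at hupper hlower ⊢
    exact abs_le.2 ⟨by linarith, by linarith⟩
  have : 0 < ‖p‖ := norm_pos_iff.2 hp
  calc ‖flatten K p z - flatten K p w - (z - w)‖
      = |gauge (K : Set 𝔼) z - gauge (K : Set 𝔼) w - ⟪p, z - w⟫| * ‖p‖⁻¹ := by
        rw [hdiff, norm_smul, norm_smul, Real.norm_eq_abs, norm_inv, norm_pow, norm_norm]
        field_simp
    _ ≤ ε * ‖p‖ * ‖z - w‖ * ‖p‖⁻¹ := by gcongr
    _ = ε * ‖z - w‖ := by field_simp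

theorem agreeUpTo_edist_flatten (hK : (0 : 𝔼) ∈ interior (K : Set 𝔼)) {p : 𝔼} (hp : p ≠ 0)
    {C : ℝ≥0} (hC : C ≠ 0) (hBp : ∀ q ∈ B, ‖q - p‖ ≤ (1 - (C : ℝ)⁻¹) * ‖p‖) {z w : 𝔼}
    (hz : z ∈ Ioc (0 : ℝ) 1 • boundaryPart K B) (hw : w ∈ Ioc (0 : ℝ) 1 • boundaryPart K B) :
    AgreeUpTo C (edist (flatten K p z) (flatten K p w)) (edist z w) := by
  obtain ⟨u, huB, huz⟩ := exists_polarPoint_mem_of_mem_Ioc_smul hK hz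
  obtain ⟨v, hvB, hvw⟩ := exists_polarPoint_mem_of_mem_Ioc_smul hK hw
  rw [edist_eq_enorm_sub, edist_eq_enorm_sub]
  exact .enorm_of_norm_sub_le hC
    (norm_flatten_sub_flatten_sub_le hK hp (hBp _ huB) (hBp _ hvB) huz hvw)

theorem agreeUpTo_polarSurfaceMeasure (hK : (0 : 𝔼) ∈ interior (K : Set 𝔼)) (hB : MeasurableSet B)
    {p : 𝔼} {C : ℝ≥0} (hC : C ≠ 0) (hBp : ∀ q ∈ B, ‖q - p‖ ≤ (1 - (C : ℝ)⁻¹) * ‖p‖) :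
    AgreeUpTo C (polarSurfaceMeasure K B) (‖p‖ₑ⁻¹ * μHE[n - 1] (boundaryPart K B)) := by
  rw [polarSurfaceMeasure_apply hK hB, ← surfaceAreaMeasure_preimage_polarPoint hK hB]
  refine .setLIntegral_const ((continuous_polarPoint hK).measurable hB) fun u hu => ?_
  have hsupport : ENNReal.ofReal (supportFun K (u : 𝔼)) = ‖polarPoint K u‖ₑ⁻¹ := by
    rw [← ofReal_norm, norm_polarPoint hK,
      ENNReal.ofReal_inv_of_pos (supportFun_coe_sphere_pos hK u), inv_inv]
  rw [hsupport]
  exact (AgreeUpTo.enorm_of_norm_sub_le hC (hBp _ hu)).inv hC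

theorem agreeUpTo_polarSurfaceMeasure_gradientMeasure [NeZero n]
    (hK : (0 : 𝔼) ∈ interior (K : Set 𝔼)) (hB : MeasurableSet B) {p : 𝔼} (hp : p ≠ 0) {C : ℝ≥0}
    (hC : C ≠ 0) (hBp : ∀ q ∈ B, ‖q - p‖ ≤ (1 - (C : ℝ)⁻¹) * ‖p‖) :
    AgreeUpTo (C ^ (2 * n)) (polarSurfaceMeasure K B) (n * gradientMeasure K B) := by
  set A := boundaryPart (K : Set 𝔼) B
  have hA_subset : A ⊆ Ioc (0 : ℝ) 1 • A := fun x hx => ⟨1, ⟨one_pos, le_rfl⟩, x, hx, one_smul _ _⟩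
  have hcone : ∀ z ∈ Ioc (0 : ℝ) 1 • A, ∀ w ∈ Ioc (0 : ℝ) 1 • A,
      AgreeUpTo C (edist (flatten K p z) (flatten K p w)) (edist z w) :=
    fun z hz w hw => agreeUpTo_edist_flatten hK hp hC hBp hz hw
  have hbase : ∀ z ∈ A, ∀ w ∈ A, AgreeUpTo C (edist (flatten K p z) (flatten K p w)) (edist z w) :=
    fun z hz w hw => hcone z (hA_subset hz) w (hA_subset hw)
  have hA_image_meas : MeasurableSet (flatten K p '' A) :=
    (measurableSet_boundaryPart hK hB).image_of_continuousOn_injOn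
      (continuous_flatten hK p).continuousOn (AgreeUpTo.injOn hbase)
  have hA_image : ∀ x ∈ flatten K p '' A, ⟪p, x⟫ = 1 := by
    rintro _ ⟨x, hx, rfl⟩
    rw [inner_flatten _ hp, gauge_eq_one_of_mem_boundaryPart hK hx]
  have hformula := finrank_mul_volume_Ioc_smul hp hA_image hA_image_meas
  have hvolume := AgreeUpTo.euclideanHausdorffMeasure_image hcone n
  rw [finrank_euclideanSpace_fin] at hformula
  rw [image_flatten_Ioc_smul, EuclideanSpace.euclideanHausdorffMeasure_eq_volume] at hvolume
  have hchain := ((agreeUpTo_polarSurfaceMeasure hK hB hC hBp).trans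
    ((AgreeUpTo.euclideanHausdorffMeasure_image hbase (n - 1)).symm.mul_left _)).trans
    (hformula ▸ hvolume.mul_left n)
  rw [gradientMeasure_apply hK hB, two_mul, pow_add]
  rwa [mul_pow_sub_one (NeZero.ne n)] at hchain

theorem inv_le_norm_polarPoint (hK : (0 : 𝔼) ∈ interior (K : Set 𝔼)) {R : ℝ}
    (hKR : (K : Set 𝔼) ⊆ Metric.closedBall 0 R) (u : 𝕊) : R⁻¹ ≤ ‖polarPoint K u‖ := by
  rw [norm_polarPoint hK]
  refine inv_anti₀ (supportFun_coe_sphere_pos hK u) ?_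
  simpa using supportFun_le_mul_norm K hKR (u : 𝔼)

theorem polarSurfaceMeasure_eq_smul_gradientMeasure [NeZero n]
    (hK : (0 : 𝔼) ∈ interior (K : Set 𝔼)) :
    polarSurfaceMeasure (K : Set 𝔼) = (n : ℝ≥0∞) • gradientMeasure (K : Set 𝔼) := by
  refine measure_eq_of_forall_agreeUpTo_of_small fun D hD => ?_
  have hn : 2 * n ≠ 0 := mul_ne_zero two_ne_zero (NeZero.ne n)
  obtain ⟨C, hC, rfl⟩ : ∃ C : ℝ≥0, 1 < C ∧ C ^ (2 * n) = D :=
    ⟨_, NNReal.one_lt_rpow hD (by positivity), NNReal.rpow_inv_natCast_pow D hn⟩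
  have hε : 0 < 1 - (C : ℝ)⁻¹ := sub_pos.2 (inv_lt_one_of_one_lt₀ hC)
  obtain ⟨R, hR, hKR⟩ := exists_pos_subset_closedBall K
  refine ⟨(1 - (C : ℝ)⁻¹) * R⁻¹, by positivity, fun B hB hB_small => ?_⟩
  rw [Measure.smul_apply, smul_eq_mul]
  obtain hB_empty | ⟨u, hu⟩ := (polarPoint (K : Set 𝔼) ⁻¹' B).eq_empty_or_nonempty
  · rw [polarSurfaceMeasure_apply hK hB, gradientMeasure_apply hK hB, boundaryPart, hB_empty]
    simp [AgreeUpTo]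
  · have hR_le := inv_le_norm_polarPoint hK hKR u
    refine agreeUpTo_polarSurfaceMeasure_gradientMeasure hK hB
      (norm_pos_iff.1 ((inv_pos.2 hR).trans_le hR_le)) (one_pos.trans hC).ne' fun q hq => ?_
    rw [← dist_eq_norm]
    exact (hB_small q hq _ hu).trans (by gcongr)

theorem integral_surfaceAreaMeasure (hK : (0 : 𝔼) ∈ interior (K : Set 𝔼)) (f : 𝔼 → ℝ) :
    ∫ u : 𝕊, f (polarPoint K u) * supportFun K (u : 𝔼) ∂surfaceAreaMeasure (K : Set 𝔼) =
      ∫ q, f q ∂polarSurfaceMeasure K := by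
  have hsupport : Measurable fun u : 𝕊 => (supportFun K (u : 𝔼)).toNNReal :=
    ((continuous_supportFun K).comp continuous_subtype_val).measurable.real_toNNReal
  rw [polarSurfaceMeasure, ((continuous_polarPoint hK).isClosedEmbedding
    (polarPoint_injective hK)).measurableEmbedding.integral_map]
  simp only [ENNReal.ofReal]
  rw [integral_withDensity_eq_integral_smul hsupport]
  refine integral_congr_ae (.of_forall fun u => ?_)
  simp only [NNReal.smul_def, Real.coe_toNNReal _ (supportFun_nonneg hK _), smul_eq_mul, mul_comm]

theorem orliczMixedVolume_eq_setIntegral [NeZero n] (hK : (0 : 𝔼) ∈ interior (K : Set 𝔼))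
    (hM : (0 : 𝔼) ∈ interior (M : Set 𝔼)) {φ : ℝ → ℝ} (hφ : ContinuousOn φ (Ioi 0)) :
    orliczMixedVolume φ (K : Set 𝔼) M = ∫ z in (K : Set 𝔼), φ (supportRatio K M z) := by
  simp only [orliczMixedVolume, ← supportFun_polarPoint hK]
  rw [integral_surfaceAreaMeasure hK fun q => φ (supportFun M q),
    polarSurfaceMeasure_eq_smul_gradientMeasure hK, integral_smul_measure, gradientMeasure,
    integral_map (measurable_gradient _).aemeasurable
      (measurable_comp_supportFun hM hφ).aestronglyMeasurable, ENNReal.toReal_natCast, smul_eq_mul,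
    one_div, inv_mul_cancel_left₀ (NeZero.ne _)]
  rfl

end ConeMeasure

section BrunnMinkowskiReal

variable {E : Type*} [NormedAddCommGroup E] [NormedSpace ℝ E] [FiniteDimensional ℝ E]
  [Nontrivial E] [MeasurableSpace E] [BorelSpace E] (μ : Measure E) [μ.IsAddHaarMeasure]

theorem measureReal_rpow_add_measureReal_rpow_le {A B : Set E} (hA : IsCompact A)
    (hB : IsCompact B) (hA_ne : A.Nonempty) (hB_ne : B.Nonempty) :
    μ.real A ^ (Module.finrank ℝ E : ℝ)⁻¹ + μ.real B ^ (Module.finrank ℝ E : ℝ)⁻¹ ≤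
      μ.real (A + B) ^ (Module.finrank ℝ E : ℝ)⁻¹ := by
  have hne_top {S : Set E} (hS : IsCompact S) : μ S ^ (Module.finrank ℝ E : ℝ)⁻¹ ≠ ⊤ :=
    ENNReal.rpow_ne_top_of_nonneg (by positivity) hS.measure_ne_top
  simp only [measureReal_def, ENNReal.toReal_rpow]
  rw [← ENNReal.toReal_add (hne_top hA) (hne_top hB)]
  exact ENNReal.toReal_mono (hne_top (hA.add hB))
    (measure_rpow_add_measure_rpow_le μ hA hB hA_ne hB_ne)

theorem one_add_pow_mul_measureReal_le {A B : Set E} (hA : IsCompact A) (hB : IsCompact B)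
    (hA_ne : A.Nonempty) (hB_ne : B.Nonempty) {s : ℝ} (hs : 0 ≤ s)
    (hBA : μ.real B = s ^ Module.finrank ℝ E * μ.real A) :
    (1 + s) ^ Module.finrank ℝ E * μ.real A ≤ μ.real (A + B) := by
  have hfinrank : Module.finrank ℝ E ≠ 0 := Module.finrank_pos.ne'
  have h := measureReal_rpow_add_measureReal_rpow_le μ hA hB hA_ne hB_ne
  rw [hBA, Real.mul_rpow (by positivity) measureReal_nonneg,
    Real.pow_rpow_inv_natCast hs hfinrank, ← one_add_mul] at h
  have hpow := pow_le_pow_left₀ (by positivity) h (Module.finrank ℝ E)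
  rwa [mul_pow, Real.rpow_inv_natCast_pow measureReal_nonneg hfinrank,
    Real.rpow_inv_natCast_pow measureReal_nonneg hfinrank] at hpow

end BrunnMinkowskiReal

section DilationRatio

variable {K M : ConvexBody (EuclideanSpace ℝ (Fin n))}

/-- The factor by which `K` has to be dilated to attain the volume of `M`, provided that `K` and `M`
have positive volume. -/
noncomputable def dilationRatio (K M : Set 𝔼) : ℝ :=
  (volume.real M / volume.real K) ^ (n : ℝ)⁻¹

theorem volumeReal_pos (hK : (0 : 𝔼) ∈ interior (K : Set 𝔼)) : 0 < volume.real (K : Set 𝔼) :=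
  ENNReal.toReal_pos
    (Measure.measure_pos_of_mem_nhds volume (mem_interior_iff_mem_nhds.1 hK)).ne'
    K.isCompact.measure_ne_top

theorem dilationRatio_pos (hK : (0 : 𝔼) ∈ interior (K : Set 𝔼))
    (hM : (0 : 𝔼) ∈ interior (M : Set 𝔼)) : 0 < dilationRatio (K : Set 𝔼) M :=
  Real.rpow_pos_of_pos (div_pos (volumeReal_pos hM) (volumeReal_pos hK)) _

theorem dilationRatio_pow_mul_volumeReal [NeZero n] (hK : (0 : 𝔼) ∈ interior (K : Set 𝔼))
    (M : Set 𝔼) : dilationRatio (K : Set 𝔼) M ^ n * volume.real (K : Set 𝔼) = volume.real M := by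
  rw [dilationRatio, Real.rpow_inv_natCast_pow (by positivity) (NeZero.ne n),
    div_mul_cancel₀ _ (volumeReal_pos hK).ne']

theorem dilationRatio_inv (K M : Set 𝔼) : (dilationRatio K M)⁻¹ = dilationRatio M K := by
  rw [dilationRatio, dilationRatio, ← Real.inv_rpow (by positivity), inv_div]

theorem volumeReal_smul (K : Set 𝔼) {c : ℝ} (hc : 0 ≤ c) :
    volume.real (c • K) = c ^ n * volume.real K := by
  rw [measureReal_def, Measure.addHaar_smul, finrank_euclideanSpace_fin, ENNReal.toReal_mul,
    abs_of_nonneg (by positivity), ENNReal.toReal_ofReal (by positivity), measureReal_def]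

theorem dilationRatio_smul [NeZero n] (K M : Set 𝔼) {c : ℝ} (hc : 0 ≤ c) :
    dilationRatio K (c • M) = c * dilationRatio K M := by
  rw [dilationRatio, volumeReal_smul M hc, mul_div_assoc, Real.mul_rpow (by positivity)
    (by positivity), Real.pow_rpow_inv_natCast hc (NeZero.ne n), dilationRatio]

end DilationRatio

section Minkowski

variable {K M : ConvexBody (EuclideanSpace ℝ (Fin n))}

theorem gauge_le_of_mem_add_smul (hK : (0 : 𝔼) ∈ interior (K : Set 𝔼)) {z : 𝔼} (hz : z ≠ 0)
    (hdiff : DifferentiableAt ℝ (gauge (K : Set 𝔼)) z) {t : ℝ} (ht : 0 ≤ t)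
    (hmem : z ∈ (K : Set 𝔼) + t • (M : Set 𝔼)) :
    gauge (K : Set 𝔼) z ≤ 1 + t * supportRatio (K : Set 𝔼) M z := by
  obtain ⟨u, hu, hinner⟩ := exists_polarPoint_eq_gradient_gauge hK hz hdiff
  obtain ⟨x, hx, _, ⟨y, hy, rfl⟩, rfl⟩ := hmem
  have hx_le : ⟪polarPoint K u, x⟫ ≤ 1 :=
    (inner_polarPoint_le_gauge hK u x).trans ((gauge_le_one_iff hK).2 hx)
  have hy_le := mul_le_mul_of_nonneg_left (inner_le_supportFun M hy (polarPoint K u)) ht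
  rw [supportRatio, ← hu, ← hinner]
  simp only [inner_add_right, real_inner_smul_right]
  exact add_le_add hx_le hy_le

theorem setOf_gauge_le_one (hK : (0 : 𝔼) ∈ interior (K : Set 𝔼)) :
    {z | gauge (K : Set 𝔼) z ≤ 1} = K :=
  ext fun _ => gauge_le_one_iff hK

theorem volumeReal_add_smul_le [NeZero n] (hK : (0 : 𝔼) ∈ interior (K : Set 𝔼))
    (hM : (0 : 𝔼) ∈ interior (M : Set 𝔼)) {t : ℝ} (ht : 0 ≤ t) :
    volume.real ((K : Set 𝔼) + t • (M : Set 𝔼)) ≤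
      ∫ z in (K : Set 𝔼), (1 + t * supportRatio (K : Set 𝔼) M z) ^ n := by
  have hpos (z : 𝔼) : 0 < 1 + t * supportRatio (K : Set 𝔼) M z :=
    add_pos_of_pos_of_nonneg one_pos (mul_nonneg ht (supportFun_nonneg hM _))
  have hmeas : Measurable fun z : 𝔼 => 1 + t * supportRatio (K : Set 𝔼) M z :=
    ((measurable_supportRatio _ M).const_mul t).const_add 1
  have hpolar := measure_setOf_le_eq_setLIntegral volume
    (continuous_gauge_of_zero_mem_interior hK).measurable hmeas
    (fun c hc z => gauge_smul_eq K hc.le z) (fun z hz => (gauge_pos_iff hK).2 hz)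
    (fun c hc z => by rw [supportRatio_smul K M hc]) hpos
  rw [setOf_gauge_le_one hK, finrank_euclideanSpace_fin] at hpolar
  have hint : IntegrableOn (fun z : 𝔼 => (1 + t * supportRatio (K : Set 𝔼) M z) ^ n) K :=
    integrableOn_comp_supportRatio hK hM (φ := fun x => (1 + t * x) ^ n) (by fun_prop)
  have hnonneg (z : 𝔼) : 0 ≤ (1 + t * supportRatio (K : Set 𝔼) M z) ^ n := (pow_pos (hpos z) n).le
  refine ENNReal.toReal_le_of_le_ofReal (integral_nonneg hnonneg) ?_
  rw [ofReal_integral_eq_lintegral_ofReal hint (Eventually.of_forall hnonneg), ← hpolar]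
  refine measure_mono_ae ?_
  filter_upwards [ae_differentiableAt_gauge hK, Measure.ae_ne volume (0 : 𝔼)] with z hdiff hz hmem
  exact gauge_le_of_mem_add_smul hK hz hdiff ht hmem

theorem one_add_mul_dilationRatio_pow_mul_volumeReal_le [NeZero n]
    (hK : (0 : 𝔼) ∈ interior (K : Set 𝔼)) {t : ℝ} (ht : 0 ≤ t) :
    (1 + t * dilationRatio (K : Set 𝔼) M) ^ n * volume.real (K : Set 𝔼) ≤
      volume.real ((K : Set 𝔼) + t • (M : Set 𝔼)) := by
  have hratio : 0 ≤ dilationRatio (K : Set 𝔼) M := Real.rpow_nonneg (by positivity) _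
  have h := one_add_pow_mul_measureReal_le volume K.isCompact (M.isCompact.smul t) K.nonempty
    M.nonempty.smul_set (mul_nonneg ht hratio) (by
      rw [volumeReal_smul _ ht, finrank_euclideanSpace_fin, mul_pow, mul_assoc,
        dilationRatio_pow_mul_volumeReal hK])
  rwa [finrank_euclideanSpace_fin] at h

theorem one_add_pow_le_one_add_mul {x : ℝ} (hx : 0 ≤ x) (n : ℕ) :
    (1 + x) ^ n ≤ 1 + n * x * (1 + x) ^ (n - 1) := by
  have h := (le_abs_self _).trans (abs_pow_sub_pow_le (1 + x) 1 n)
  rw [one_pow, add_sub_cancel_left, abs_of_nonneg hx, abs_of_nonneg (by linarith), abs_one,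
    max_eq_left (by linarith)] at h
  linarith

theorem dilationRatio_mul_volumeReal_le [NeZero n] (hK : (0 : 𝔼) ∈ interior (K : Set 𝔼))
    (hM : (0 : 𝔼) ∈ interior (M : Set 𝔼)) {C : ℝ}
    (hC : ∀ᵐ z : 𝔼, supportRatio (K : Set 𝔼) M z ≤ C) {t : ℝ} (ht : 0 < t) :
    dilationRatio (K : Set 𝔼) M * volume.real (K : Set 𝔼) ≤
      (1 + t * C) ^ (n - 1) * ∫ z in (K : Set 𝔼), supportRatio (K : Set 𝔼) M z := by
  have hn : (0 : ℝ) < n := by exact_mod_cast NeZero.pos n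
  have hint := integrableOn_supportRatio hK hM
  have hint_const := integrableOn_const (C := (1 : ℝ)) (K.isCompact.measure_ne_top (μ := volume))
  have hint_mul := hint.const_mul (n * t * (1 + t * C) ^ (n - 1))
  have hupper : ∫ z in (K : Set 𝔼), (1 + t * supportRatio (K : Set 𝔼) M z) ^ n ≤
      ∫ z in (K : Set 𝔼), (1 + n * t * (1 + t * C) ^ (n - 1) * supportRatio (K : Set 𝔼) M z) := by
    refine integral_mono_ae
      (integrableOn_comp_supportRatio hK hM (φ := fun x => (1 + t * x) ^ n) (by fun_prop))
      (hint_const.add hint_mul) (ae_restrict_of_ae (hC.mono fun z hz => ?_))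
    have hnonneg : 0 ≤ supportRatio (K : Set 𝔼) M z := supportFun_nonneg hM _
    calc (1 + t * supportRatio (K : Set 𝔼) M z) ^ n
        ≤ 1 + n * (t * supportRatio (K : Set 𝔼) M z) *
            (1 + t * supportRatio (K : Set 𝔼) M z) ^ (n - 1) :=
          one_add_pow_le_one_add_mul (by positivity) n
      _ ≤ 1 + n * (t * supportRatio (K : Set 𝔼) M z) * (1 + t * C) ^ (n - 1) := by gcongr
      _ = 1 + n * t * (1 + t * C) ^ (n - 1) * supportRatio (K : Set 𝔼) M z := by ring
  rw [integral_add hint_const hint_mul, setIntegral_const, smul_eq_mul, mul_one,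
    integral_const_mul] at hupper
  have hratio : 0 ≤ dilationRatio (K : Set 𝔼) M := (dilationRatio_pos hK hM).le
  have hbernoulli := mul_le_mul_of_nonneg_right
    (one_add_mul_le_pow (a := t * dilationRatio (K : Set 𝔼) M)
      (by linarith [mul_nonneg ht.le hratio]) n)
    (volumeReal_pos hK).le
  have hchain := hbernoulli.trans <|
    (one_add_mul_dilationRatio_pow_mul_volumeReal_le hK ht.le).trans
      ((volumeReal_add_smul_le hK hM ht.le).trans hupper)
  refine le_of_mul_le_mul_left ?_ (mul_pos hn ht)
  linarith

theorem dilationRatio_le_setAverage_supportRatio [NeZero n] (hK : (0 : 𝔼) ∈ interior (K : Set 𝔼))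
    (hM : (0 : 𝔼) ∈ interior (M : Set 𝔼)) :
    dilationRatio (K : Set 𝔼) M ≤ ⨍ z in (K : Set 𝔼), supportRatio (K : Set 𝔼) M z := by
  obtain ⟨_, C, _, hmem⟩ := exists_ae_supportRatio_mem_Icc hK hM
  rw [setAverage_eq, smul_eq_mul, inv_mul_eq_div, le_div_iff₀ (volumeReal_pos hK)]
  have hlim : Tendsto (fun t : ℝ => (1 + t * C) ^ (n - 1) *
      ∫ z in (K : Set 𝔼), supportRatio (K : Set 𝔼) M z) (𝓝[>] 0)
      (𝓝 (∫ z in (K : Set 𝔼), supportRatio (K : Set 𝔼) M z)) :=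
    tendsto_nhdsWithin_of_tendsto_nhds (Continuous.tendsto' (by fun_prop) _ _ (by simp))
  exact ge_of_tendsto hlim (eventually_mem_nhdsWithin.mono fun t ht =>
    dilationRatio_mul_volumeReal_le hK hM (hmem.mono fun z hz => hz.2) ht)

end Minkowski

section AeSubset

variable {X : Type*} [TopologicalSpace X] [MeasurableSpace X]
  {μ : Measure X} [μ.IsOpenPosMeasure] {A S : Set X}

theorem subset_of_ae_le (hA : A ⊆ closure (interior A)) (hS : IsClosed S) (h : A ≤ᵐ[μ] S) :
    A ⊆ S := by
  have hnull : μ (interior A \ S) = 0 :=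
    measure_mono_null (sdiff_subset_sdiff_left interior_subset) (ae_le_set.1 h)
  have hsub : interior A ⊆ S :=
    sdiff_eq_empty.1 ((isOpen_interior.sdiff hS).eq_empty_of_measure_zero hnull)
  exact hA.trans (closure_minimal hsub hS)

theorem eq_of_subset_of_measure_le [OpensMeasurableSpace X] (hA : A ⊆ closure (interior A))
    (hS : IsClosed S) (hSA : S ⊆ A) (hA_top : μ A ≠ ⊤) (h : μ A ≤ μ S) : S = A :=
  hSA.antisymm <| subset_of_ae_le (μ := μ) hA hS
    (ae_eq_of_subset_of_measure_ge hSA h hS.nullMeasurableSet hA_top).symm.le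

end AeSubset

theorem ae_restrict_smul_of_ae_restrict {E : Type*} [NormedAddCommGroup E] [NormedSpace ℝ E]
    [FiniteDimensional ℝ E] [MeasurableSpace E] [BorelSpace E] {μ : Measure E}
    [μ.IsAddHaarMeasure] {s : Set E} (hs : MeasurableSet s) {c : ℝ} (hc : c ≠ 0) {p : E → Prop}
    (h : ∀ᵐ z ∂μ.restrict s, p z) : ∀ᵐ z ∂μ.restrict (c • s), p (c⁻¹ • z) := by
  rw [ae_restrict_iff' hs, ae_iff] at h
  rw [ae_restrict_iff' (hs.const_smul₀ c), ae_iff]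
  have hpreimage : {z | ¬(z ∈ c • s → p (c⁻¹ • z))} = (c⁻¹ • ·) ⁻¹' {z | ¬(z ∈ s → p z)} := by
    ext z
    simp only [mem_smul_set_iff_inv_smul_mem₀ hc, mem_ofPred_eq, mem_preimage]
  rw [hpreimage, Measure.addHaar_preimage_smul μ (inv_ne_zero hc), h, mul_zero]

section OrliczMinkowski

variable {K M : ConvexBody (EuclideanSpace ℝ (Fin n))}

theorem subset_closure_interior (hK : (0 : 𝔼) ∈ interior (K : Set 𝔼)) :
    (K : Set 𝔼) ⊆ closure (interior (K : Set 𝔼)) := by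
  rw [K.convex.closure_interior_eq_closure_of_nonempty_interior ⟨0, hK⟩]
  exact subset_closure

theorem zero_mem_interior_smul (hK : (0 : 𝔼) ∈ interior (K : Set 𝔼)) {c : ℝ} (hc : c ≠ 0) :
    (0 : 𝔼) ∈ interior ((c • K : ConvexBody 𝔼) : Set 𝔼) := by
  rw [ConvexBody.coe_smul, interior_smul₀ hc]
  exact ⟨0, hK, smul_zero c⟩

theorem ae_restrict_supportRatio_eq (hK : (0 : 𝔼) ∈ interior (K : Set 𝔼)) {N : Set 𝔼} {c : ℝ}
    (h : ∀ᵐ z ∂volume.restrict (K : Set 𝔼), supportRatio (K : Set 𝔼) N z = c) :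
    ∀ᵐ z ∂volume.restrict (M : Set 𝔼), supportRatio (K : Set 𝔼) N z = c := by
  obtain ⟨r, hr, hr_smul⟩ := (NormedSpace.isVonNBounded_of_isBounded ℝ M.isBounded
    (mem_interior_iff_mem_nhds.1 hK)).exists_pos
  have hMr : (M : Set 𝔼) ⊆ r • (K : Set 𝔼) := hr_smul r (le_abs_self r)
  refine ae_restrict_of_ae_restrict_of_subset hMr ?_
  simpa only [supportRatio_smul K N (inv_pos.2 hr)] using
    ae_restrict_smul_of_ae_restrict K.isClosed.measurableSet hr.ne' h

theorem subset_smul_of_ae_supportRatio_eq [NeZero n] (hK : (0 : 𝔼) ∈ interior (K : Set 𝔼))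
    (hM : (0 : 𝔼) ∈ interior (M : Set 𝔼)) {c : ℝ} (hc : 0 < c)
    (h : ∀ᵐ z ∂volume.restrict (K : Set 𝔼), supportRatio (K : Set 𝔼) M z = c) :
    (M : Set 𝔼) ⊆ c • (K : Set 𝔼) := by
  refine subset_of_ae_le (μ := volume) (subset_closure_interior hM)
    (K.isClosed.smul_of_ne_zero hc.ne') ?_
  refine (ae_restrict_iff' M.isClosed.measurableSet).1 ?_
  filter_upwards [ae_restrict_supportRatio_eq (M := M) hK h,
    ae_restrict_mem M.isClosed.measurableSet, ae_restrict_of_ae (ae_differentiableAt_gauge hK),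
    ae_restrict_of_ae (Measure.ae_ne volume (0 : 𝔼))] with z hz hzM hdiff hz_ne
  obtain ⟨u, hu, hinner⟩ := exists_polarPoint_eq_gradient_gauge hK hz_ne hdiff
  have hgauge : gauge (K : Set 𝔼) z ≤ c := by
    rw [← hinner, ← hz, supportRatio, ← hu]
    exact inner_le_supportFun M hzM _
  change z ∈ c • (K : Set 𝔼)
  rw [mem_smul_set_iff_inv_smul_mem₀ hc.ne', SetLike.mem_coe, ← gauge_le_one_iff hK,
    gauge_smul_eq K (inv_nonneg.2 hc.le), inv_mul_le_one₀ hc]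
  exact hgauge

theorem eq_smul_of_ae_supportRatio_eq [NeZero n] (hK : (0 : 𝔼) ∈ interior (K : Set 𝔼))
    (hM : (0 : 𝔼) ∈ interior (M : Set 𝔼))
    (h : ∀ᵐ z ∂volume.restrict (K : Set 𝔼),
      supportRatio (K : Set 𝔼) M z = dilationRatio (K : Set 𝔼) M) :
    M = dilationRatio (K : Set 𝔼) M • K := by
  have hpos := dilationRatio_pos hK hM
  have hsub := subset_smul_of_ae_supportRatio_eq hK hM hpos h
  have hvol : volume.real ((dilationRatio (K : Set 𝔼) M • K : ConvexBody 𝔼) : Set 𝔼) =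
      volume.real (M : Set 𝔼) := by
    rw [ConvexBody.coe_smul, volumeReal_smul _ hpos.le, dilationRatio_pow_mul_volumeReal hK]
  rw [← ConvexBody.coe_smul] at hsub
  refine SetLike.coe_injective (eq_of_subset_of_measure_le (μ := volume)
    (subset_closure_interior (zero_mem_interior_smul hK hpos.ne')) M.isClosed hsub
    (ConvexBody.isCompact _).measure_ne_top ?_)
  exact ((measureReal_eq_measureReal_iff (ConvexBody.isCompact _).measure_ne_top
    M.isCompact.measure_ne_top).1 hvol).le

variable {φ : ℝ → ℝ}

theorem ae_supportRatio_eq_setAverage_or_lt [NeZero n] (hK : (0 : 𝔼) ∈ interior (K : Set 𝔼))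
    (hM : (0 : 𝔼) ∈ interior (M : Set 𝔼)) (hφ : StrictConvexOn ℝ (Ioi 0) φ) :
    (∀ᵐ z ∂volume.restrict (K : Set 𝔼),
        supportRatio (K : Set 𝔼) M z = ⨍ w in (K : Set 𝔼), supportRatio (K : Set 𝔼) M w) ∨
      φ (⨍ z in (K : Set 𝔼), supportRatio (K : Set 𝔼) M z) * volume.real (K : Set 𝔼) <
        orliczMixedVolume φ (K : Set 𝔼) M := by
  have hcont : ContinuousOn φ (Ioi 0) := hφ.convexOn.continuousOn isOpen_Ioi
  obtain ⟨a, b, ha, hmem⟩ := exists_ae_supportRatio_mem_Icc hK hM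
  have hIcc : Icc a b ⊆ Ioi 0 := fun x hx => ha.trans_le hx.1
  have : IsFiniteMeasure (volume.restrict (K : Set 𝔼)) := ⟨by
    simpa using K.isCompact.measure_lt_top⟩
  refine ((hφ.subset hIcc (convex_Icc a b)).ae_eq_const_or_map_average_lt (hcont.mono hIcc)
    isClosed_Icc (ae_restrict_of_ae hmem) (integrableOn_supportRatio hK hM)
    (integrableOn_comp_supportRatio hK hM hcont)).imp_right fun hlt => ?_
  rwa [setAverage_eq volume (fun z : 𝔼 => φ (supportRatio (K : Set 𝔼) M z)), smul_eq_mul,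
    inv_mul_eq_div, lt_div_iff₀ (volumeReal_pos hK),
    ← orliczMixedVolume_eq_setIntegral hK hM hcont] at hlt

theorem eq_smul_or_map_dilationRatio_mul_lt [NeZero n] (hK : (0 : 𝔼) ∈ interior (K : Set 𝔼))
    (hM : (0 : 𝔼) ∈ interior (M : Set 𝔼)) (hφ_mono : StrictMonoOn φ (Ioi 0))
    (hφ_conv : StrictConvexOn ℝ (Ioi 0) φ) :
    M = dilationRatio (K : Set 𝔼) M • K ∨
      φ (dilationRatio (K : Set 𝔼) M) * volume.real (K : Set 𝔼) <
        orliczMixedVolume φ (K : Set 𝔼) M := by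
  have hpos := dilationRatio_pos hK hM
  have hle := dilationRatio_le_setAverage_supportRatio hK hM
  rcases ae_supportRatio_eq_setAverage_or_lt hK hM hφ_conv with hconst | hlt
  · rcases hle.eq_or_lt with heq | hlt
    · exact .inl (eq_smul_of_ae_supportRatio_eq hK hM (by rwa [← heq] at hconst))
    · right
      rw [orliczMixedVolume_eq_setIntegral hK hM (hφ_conv.convexOn.continuousOn isOpen_Ioi),
        integral_congr_ae (hconst.mono fun z hz => congrArg φ hz), setIntegral_const, smul_eq_mul,
        mul_comm]
      exact mul_lt_mul_of_pos_left (hφ_mono hpos (hpos.trans hlt) hlt) (volumeReal_pos hK)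
  · right
    refine lt_of_le_of_lt (mul_le_mul_of_nonneg_right ?_ (volumeReal_pos hK).le) hlt
    exact hφ_mono.monotoneOn hpos (hpos.trans_le hle) hle

theorem orliczMixedVolume_smul_self [NeZero n] (hK : (0 : 𝔼) ∈ interior (K : Set 𝔼))
    (hφ : ContinuousOn φ (Ioi 0)) {c : ℝ} (hc : 0 < c) :
    orliczMixedVolume φ (K : Set 𝔼) (c • K : ConvexBody 𝔼) = φ c * volume.real (K : Set 𝔼) := by
  have hratio : ∀ᵐ z ∂volume.restrict (K : Set 𝔼),
      φ (supportRatio (K : Set 𝔼) (c • K : ConvexBody 𝔼) z) = φ c := by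
    filter_upwards [ae_restrict_of_ae (ae_differentiableAt_gauge hK),
      ae_restrict_of_ae (Measure.ae_ne volume (0 : 𝔼))] with z hdiff hz
    obtain ⟨u, hu, -⟩ := exists_polarPoint_eq_gradient_gauge hK hz hdiff
    rw [supportRatio, ← hu, ConvexBody.coe_smul, supportFun_smul_set K hc.le,
      supportFun_polarPoint hK, div_self (supportFun_coe_sphere_pos hK u).ne', mul_one]
  rw [orliczMixedVolume_eq_setIntegral hK (zero_mem_interior_smul hK hc.ne') hφ,
    integral_congr_ae hratio, setIntegral_const, smul_eq_mul, mul_comm]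

theorem map_dilationRatio_mul_le_orliczMixedVolume [NeZero n]
    (hK : (0 : 𝔼) ∈ interior (K : Set 𝔼)) (hM : (0 : 𝔼) ∈ interior (M : Set 𝔼))
    (hφ_mono : StrictMonoOn φ (Ioi 0)) (hφ_conv : StrictConvexOn ℝ (Ioi 0) φ) :
    φ (dilationRatio (K : Set 𝔼) M) * volume.real (K : Set 𝔼) ≤
      orliczMixedVolume φ (K : Set 𝔼) M := by
  rcases eq_smul_or_map_dilationRatio_mul_lt hK hM hφ_mono hφ_conv with heq | hlt
  · conv_rhs => rw [heq]
    rw [orliczMixedVolume_smul_self hK (hφ_conv.convexOn.continuousOn isOpen_Ioi)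
      (dilationRatio_pos hK hM)]
  · exact hlt.le

end OrliczMinkowski

section Uniqueness

variable {K L : ConvexBody (EuclideanSpace ℝ (Fin n))} {φ : ℝ → ℝ}

theorem map_mul_dilationRatio_mul_le [NeZero n] (hK : (0 : 𝔼) ∈ interior (K : Set 𝔼))
    (hL : (0 : 𝔼) ∈ interior (L : Set 𝔼)) (hφ_mono : StrictMonoOn φ (Ioi 0))
    (hφ_conv : StrictConvexOn ℝ (Ioi 0) φ)
    (hV : ∀ M : ConvexBody 𝔼, (0 : 𝔼) ∈ interior (M : Set 𝔼) →
      orliczMixedVolume φ (K : Set 𝔼) M = orliczMixedVolume φ (L : Set 𝔼) M)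
    {c : ℝ} (hc : 0 < c) :
    φ (c * dilationRatio (L : Set 𝔼) K) * volume.real (L : Set 𝔼) ≤
      φ c * volume.real (K : Set 𝔼) := by
  have hcK := zero_mem_interior_smul hK hc.ne'
  have h := map_dilationRatio_mul_le_orliczMixedVolume hL hcK hφ_mono hφ_conv
  rwa [← hV _ hcK, orliczMixedVolume_smul_self hK (hφ_conv.convexOn.continuousOn isOpen_Ioi) hc,
    ConvexBody.coe_smul, dilationRatio_smul _ _ hc.le] at h

theorem map_dilationRatio_mul_eq [NeZero n] (hK : (0 : 𝔼) ∈ interior (K : Set 𝔼))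
    (hL : (0 : 𝔼) ∈ interior (L : Set 𝔼)) (hφ_mono : StrictMonoOn φ (Ioi 0))
    (hφ_conv : StrictConvexOn ℝ (Ioi 0) φ)
    (hV : ∀ M : ConvexBody 𝔼, (0 : 𝔼) ∈ interior (M : Set 𝔼) →
      orliczMixedVolume φ (K : Set 𝔼) M = orliczMixedVolume φ (L : Set 𝔼) M)
    {c : ℝ} (hc : 0 < c) :
    φ (dilationRatio (L : Set 𝔼) K * c) = dilationRatio (L : Set 𝔼) K ^ n * φ c := by
  have hr := dilationRatio_pos hL hK
  have hle := map_mul_dilationRatio_mul_le hK hL hφ_mono hφ_conv hV hc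
  have hge := map_mul_dilationRatio_mul_le hL hK hφ_mono hφ_conv
    (fun M hM => (hV M hM).symm) (mul_pos hc hr)
  rw [← dilationRatio_inv (L : Set 𝔼) K, mul_inv_cancel_right₀ hr.ne'] at hge
  have heq := hle.antisymm hge
  rw [← dilationRatio_pow_mul_volumeReal hL (K : Set 𝔼), ← mul_assoc] at heq
  rw [mul_comm _ c, mul_right_cancel₀ (volumeReal_pos hL).ne' heq, mul_comm]

theorem eq_dilationRatio_smul [NeZero n] (hK : (0 : 𝔼) ∈ interior (K : Set 𝔼))
    (hL : (0 : 𝔼) ∈ interior (L : Set 𝔼)) (hφ_mono : StrictMonoOn φ (Ioi 0))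
    (hφ_conv : StrictConvexOn ℝ (Ioi 0) φ)
    (hV : ∀ M : ConvexBody 𝔼, (0 : 𝔼) ∈ interior (M : Set 𝔼) →
      orliczMixedVolume φ (K : Set 𝔼) M = orliczMixedVolume φ (L : Set 𝔼) M) :
    K = dilationRatio (L : Set 𝔼) K • L := by
  refine (eq_smul_or_map_dilationRatio_mul_lt hL hK hφ_mono hφ_conv).resolve_right
    (not_lt_of_ge (le_of_eq ?_))
  have hcont : ContinuousOn φ (Ioi 0) := hφ_conv.convexOn.continuousOn isOpen_Ioi
  have hself := orliczMixedVolume_smul_self hK hcont one_pos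
  have hmap := map_dilationRatio_mul_eq hK hL hφ_mono hφ_conv hV one_pos
  rw [one_smul] at hself
  rw [mul_one] at hmap
  rw [← hV K hK, hself, hmap, mul_right_comm, dilationRatio_pow_mul_volumeReal hL, mul_comm]

end Uniqueness

end OrliczMixed

theorem mainTheorem11_general (n : ℕ) [NeZero n] (K L : ConvexBody (EuclideanSpace ℝ (Fin n)))
    (hK : (0 : EuclideanSpace ℝ (Fin n)) ∈ interior (K : Set (EuclideanSpace ℝ (Fin n))))
    (hL : (0 : EuclideanSpace ℝ (Fin n)) ∈ interior (L : Set (EuclideanSpace ℝ (Fin n))))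
    (φ : ℝ → ℝ) (hφ : StrictMonoOn φ (Ioi 0)) (hconv : StrictConvexOn ℝ (Ioi 0) φ)
    (hV : ∀ M : ConvexBody (EuclideanSpace ℝ (Fin n)),
      (0 : EuclideanSpace ℝ (Fin n)) ∈ interior (M : Set (EuclideanSpace ℝ (Fin n))) →
        OrliczMixed.orliczMixedVolume φ (K : Set (EuclideanSpace ℝ (Fin n))) M =
          OrliczMixed.orliczMixedVolume φ (L : Set (EuclideanSpace ℝ (Fin n))) M) :
    OrliczMixed.IsDilatate (K : Set (EuclideanSpace ℝ (Fin n))) L ∧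
      (¬ OrliczMixed.BehavesLikePow n φ → K = L) := by
  set r := OrliczMixed.dilationRatio (L : Set (EuclideanSpace ℝ (Fin n))) K
  have hr : 0 < r := OrliczMixed.dilationRatio_pos hL hK
  have hKL : K = r • L := OrliczMixed.eq_dilationRatio_smul hK hL hφ hconv hV
  refine ⟨⟨r⁻¹, inv_pos.2 hr, ?_⟩, fun hφ_pow => ?_⟩
  · rw [hKL, ConvexBody.coe_smul, inv_smul_smul₀ hr.ne']
  · have hr_one : r = 1 := by
      by_contra hr_ne
      exact hφ_pow ⟨r, hr, hr_ne, fun t ht =>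
        OrliczMixed.map_dilationRatio_mul_eq hK hL hφ hconv hV ht⟩
    rw [hKL, hr_one, one_smul]

theorem mainTheorem11 (n : ℕ) (hn : 2 ≤ n)
    (K L : ConvexBody (EuclideanSpace ℝ (Fin n)))
    (hK : (0 : EuclideanSpace ℝ (Fin n)) ∈ interior (K : Set (EuclideanSpace ℝ (Fin n))))
    (hL : (0 : EuclideanSpace ℝ (Fin n)) ∈ interior (L : Set (EuclideanSpace ℝ (Fin n))))
    (φ : ℝ → ℝ) (hφ : OrliczMixed.ClassI φ) (hconv : StrictConvexOn ℝ (Set.Ioi 0) φ)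
    (hV : ∀ M : ConvexBody (EuclideanSpace ℝ (Fin n)),
      (0 : EuclideanSpace ℝ (Fin n)) ∈ interior (M : Set (EuclideanSpace ℝ (Fin n))) →
        OrliczMixed.orliczMixedVolume φ (K : Set (EuclideanSpace ℝ (Fin n))) M =
          OrliczMixed.orliczMixedVolume φ (L : Set (EuclideanSpace ℝ (Fin n))) M) :
    OrliczMixed.IsDilatate (K : Set (EuclideanSpace ℝ (Fin n))) L ∧
      (¬ OrliczMixed.BehavesLikePow n φ → K = L) := by
  have : NeZero n := ⟨by omega⟩
  exact mainTheorem11_general n K L hK hL φ hφ.strictMonoOn hconv hV
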